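/- Let $n\ge 3$, let $\mathbb S=\{Y\in\mathbb R^{n\times n}: Y=Y^\top,\ Y\mathbf 1=\mathbf 0\}$ with the trace inner product $\langle A,B\rangle=\operatorname{Tr}(A^\top B)$ (whose norm is the Frobenius norm $\|\cdot\|_{\mathrm F}$), let $\mathbb I=\{(i,j):1\le i<j\le n\}$ and $L=n(n-1)/2=|\mathbb I|$. For $\alpha=(i,j)\in\mathbb I$ put $w_\alpha=e_{ii}+e_{jj}-e_{ij}-e_{ji}$, where $e_{ij}$ are the standard matrix units, and let $v_\alpha=-\tfrac12(ab^\top+ba^\top)$ with $a=e_i-\tfrac1n\mathbf 1$, $b=e_j-\tfrac1n\mathbf 1$ be the basis of $\mathbb S$ dual to $(w_\alpha)$. Let $X\in\mathbb S$ have rank $r$ and thin spectral decomposition $X=UDU^\top$, with $U\in\mathbb R^{n\times r}$, $U^\top U=I$, and $D$ diagonal. Put $\mathcal P_U=UU^\top$ and $\mathcal P_{\mathbb T}Y=\mathcal P_UY+Y\mathcal P_U-\mathcal P_UY\mathcal P_U$; $\mathcal P_{\mathbb T}$ maps $\mathbb S$ to $\mathbb S$. Assume that $X$ is incoherent with constant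 $\nu\ge 1$: for all $\alpha=(i,j)\in\mathbb I$ and for both $\mathcal P=\mathcal P_U$ (acting by left multiplication) and $\mathcal P=\mathcal P_{\mathbb T}$, $$\|\mathcal P e_{ij}\|_{\mathrm F}\le\sqrt{\tfrac{\nu r}{128n}},\qquad \|\mathcal P w_\alpha\|_{\mathrm F}\le\sqrt{\tfrac{\nu r}{8n}},\qquad \|\mathcal P v_\alpha\|_{\mathrm F}\le\sqrt{\tfrac{\nu r}{2n}}.$$ Let $\Omega=(\alpha_1,\dots,\alpha_m)$ be $m$ indices drawn independently and uniformly from $\mathbb I$ (with replacement), let $\mathcal R_\Omega=\sum_{k=1}^m\langle\cdot,w_{\alpha_k}\rangle v_{\alpha_k}:\mathbb S\to\mathbb S$, let $\mathcal R_\Omega^\star$ be its adjoint, and let $\|\cdot\|$ be the operator norm of linear maps $\mathbb S\to\mathbb S$. Let $\beta\in\mathbb R$ and suppose $m\ge\frac83\beta\nu^2r^2n\log n$. Then with probability at least $1-2n^{1-\beta}$ the following hold simultaneously: $$\frac Lm\Big\|\mathcal P_{\mathbb T}\mathcal R_\Omega\mathcal P_{\mathbb T}-\frac mL\mathcal P_{\mathbb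 T}\Big\|\le\sqrt{\frac{8\beta\nu^2r^2n\log n}{3m}},\qquad \frac Lm\Big\|\mathcal P_{\mathbb T}\mathcal R_\Omega^\star\mathcal P_{\mathbb T}-\frac mL\mathcal P_{\mathbb T}\Big\|\le\sqrt{\frac{8\beta\nu^2r^2n\log n}{3m}},$$ and, for every $\varepsilon_0>0$ for which moreover $m\ge\frac83\beta\left(\frac{\nu r}{\varepsilon_0}\right)^2n\log n$, both left-hand sides are at most $\varepsilon_0$. (For $\varepsilon_0\le1$ the last condition on $m$ already implies the first one.) -/

import Mathlib

open Matrix MeasureTheory ProbabilityTheory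

namespace EDG

/-- The space `𝕊` of symmetric `n × n` matrices with zero row sums. -/
def centeredSymm (n : ℕ) : Submodule ℝ (Matrix (Fin n) (Fin n) ℝ) where
  carrier := {Y | Yᵀ = Y ∧ Y *ᵥ 1 = 0}
  add_mem' := by
    rintro A B ⟨hA, hA'⟩ ⟨hB, hB'⟩
    exact ⟨by rw [Matrix.transpose_add, hA, hB], by rw [Matrix.add_mulVec, hA', hB', add_zero]⟩
  zero_mem' := ⟨Matrix.transpose_zero, Matrix.zero_mulVec _⟩
  smul_mem' := by
    rintro c A ⟨hA, hA'⟩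
    exact ⟨by rw [Matrix.transpose_smul, hA], by rw [Matrix.smul_mulVec, hA', smul_zero]⟩

/-- `𝕊` as a type of its own. It carries the trace inner product `⟨A, B⟩ = Tr(Aᵀ B)`, whose norm is
the Frobenius norm; operators on `𝕊` carry the corresponding operator norm. -/
def SMat (n : ℕ) : Type := centeredSymm n

namespace SMat

variable {n : ℕ}

instance : AddCommGroup (SMat n) := inferInstanceAs (AddCommGroup (centeredSymm n))

instance : Module ℝ (SMat n) := inferInstanceAs (Module ℝ (centeredSymm n))

instance : FiniteDimensional ℝ (SMat n) :=
  inferInstanceAs (FiniteDimensional ℝ (centeredSymm n))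

/-- The inclusion of `𝕊` into all `n × n` matrices. -/
def toMat : SMat n →ₗ[ℝ] Matrix (Fin n) (Fin n) ℝ := (centeredSymm n).subtype

theorem toMat_injective : Function.Injective (toMat : SMat n → Matrix (Fin n) (Fin n) ℝ) :=
  Subtype.val_injective

theorem toMat_mem (A : SMat n) : toMat A ∈ centeredSymm n := A.2

theorem trace_self (A : Matrix (Fin n) (Fin n) ℝ) :
    trace (Aᵀ * A) = ∑ i, ∑ j, A j i ^ 2 := by
  simp [Matrix.trace, Matrix.mul_apply, sq]

/-- The trace inner product on `𝕊`. -/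
@[reducible]
noncomputable def core (n : ℕ) : InnerProductSpace.Core ℝ (SMat n) where
  inner A B := trace ((toMat A)ᵀ * toMat B)
  conj_inner_symm A B := by
    rw [← Matrix.trace_transpose, Matrix.transpose_mul, Matrix.transpose_transpose]
    rfl
  re_inner_nonneg A := by
    rw [trace_self, RCLike.re_to_real]
    exact Finset.sum_nonneg fun i _ => Finset.sum_nonneg fun j _ => sq_nonneg (toMat A j i)
  add_left A B C := by
    rw [map_add, Matrix.transpose_add, Matrix.add_mul, Matrix.trace_add]
  smul_left A B c := by
    rw [map_smul, Matrix.transpose_smul, Matrix.smul_mul, Matrix.trace_smul]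
    rfl
  definite A h := by
    rw [trace_self] at h
    apply toMat_injective
    rw [map_zero]
    ext i j
    have h1 : ∑ l, toMat A l j ^ 2 = 0 := (Finset.sum_eq_zero_iff_of_nonneg fun k _ =>
      Finset.sum_nonneg fun l _ => sq_nonneg (toMat A l k)).mp h j (Finset.mem_univ _)
    have h2 : toMat A i j ^ 2 = 0 := (Finset.sum_eq_zero_iff_of_nonneg fun l _ =>
      sq_nonneg (toMat A l j)).mp h1 i (Finset.mem_univ _)
    exact pow_eq_zero_iff two_ne_zero |>.mp h2

noncomputable instance : NormedAddCommGroup (SMat n) := (core n).toNormedAddCommGroup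

noncomputable instance : InnerProductSpace ℝ (SMat n) := InnerProductSpace.ofCore (core n).toCore

instance : CompleteSpace (SMat n) := FiniteDimensional.complete ℝ (SMat n)

theorem inner_eq (A B : SMat n) : inner ℝ A B = trace ((toMat A)ᵀ * toMat B) := rfl

end SMat

/-- The Frobenius norm `‖A‖_F = √Tr(Aᵀ A)`. -/
noncomputable def frobNorm {n : ℕ} (A : Matrix (Fin n) (Fin n) ℝ) : ℝ := √(trace (Aᵀ * A))

/-- The index set `𝕀 = {(i, j) : i < j}`. -/
abbrev Idx (n : ℕ) : Type := {p : Fin n × Fin n // p.1 < p.2}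

/-- `L = n (n - 1) / 2`, the number of indices (and the dimension of `𝕊`). -/
noncomputable def numIdx (n : ℕ) : ℝ := (n : ℝ) * ((n : ℝ) - 1) / 2

/-- The standard matrix unit `e_{ij}`. -/
def e {n : ℕ} (i j : Fin n) : Matrix (Fin n) (Fin n) ℝ := Matrix.single i j 1

/-- `w_α = e_{ii} + e_{jj} - e_{ij} - e_{ji}` for `α = (i, j)`. -/
def w {n : ℕ} (α : Idx n) : Matrix (Fin n) (Fin n) ℝ :=
  e α.1.1 α.1.1 + e α.1.2 α.1.2 - e α.1.1 α.1.2 - e α.1.2 α.1.1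

/-- The centred coordinate vector `e_i - (1/n) 𝟏`. -/
noncomputable def cvec {n : ℕ} (i : Fin n) : Fin n → ℝ :=
  fun k => (Pi.single i 1 : Fin n → ℝ) k - 1 / (n : ℝ)

/-- The dual basis `v_α = -(a bᵀ + b aᵀ)/2`, `a = e_i - (1/n) 𝟏`, `b = e_j - (1/n) 𝟏`, for
`α = (i, j)`; see `trace_w_v` for bi-orthogonality. -/
noncomputable def v {n : ℕ} (α : Idx n) : Matrix (Fin n) (Fin n) ℝ :=
  (-(1 / 2 : ℝ)) •
    (vecMulVec (cvec α.1.1) (cvec α.1.2) + vecMulVec (cvec α.1.2) (cvec α.1.1))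

theorem sum_cvec {n : ℕ} (i : Fin n) : cvec i ⬝ᵥ 1 = 0 := by
  have hn : (n : ℝ) ≠ 0 := by
    have := i.pos
    positivity
  simp [cvec, dotProduct, Finset.sum_sub_distrib, hn]

theorem w_mem {n : ℕ} (α : Idx n) : w α ∈ centeredSymm n := by
  constructor
  · simp only [w, e, Matrix.transpose_sub, Matrix.transpose_add, Matrix.transpose_single]
    abel
  · simp only [w, e, Matrix.sub_mulVec, Matrix.add_mulVec, Matrix.single_mulVec]
    ext k
    simp

theorem v_mem {n : ℕ} (α : Idx n) : v α ∈ centeredSymm n := by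
  constructor
  · simp only [v, Matrix.transpose_smul, Matrix.transpose_add, Matrix.transpose_vecMulVec]
    rw [add_comm]
  · simp only [v, Matrix.smul_mulVec, Matrix.add_mulVec, Matrix.vecMulVec_mulVec, sum_cvec]
    simp

/-- Bi-orthogonality of the two bases. -/
theorem trace_w_v {n : ℕ} (α β : Idx n) :
    trace ((w α)ᵀ * v β) = if α = β then 1 else 0 := by
  obtain ⟨⟨i, j⟩, hij⟩ := α
  obtain ⟨⟨k, l⟩, hkl⟩ := β
  simp only at hij hkl
  rw [(w_mem _).1]
  simp only [w, e, Matrix.sub_mul, Matrix.add_mul, Matrix.trace_sub, Matrix.trace_add,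
    Matrix.trace_single_mul, v, Matrix.smul_apply, Matrix.add_apply, Matrix.vecMulVec_apply, cvec,
    Pi.single_apply, smul_eq_mul, Subtype.mk.injEq, Prod.mk.injEq, one_mul]
  have hkl' := hkl.ne
  have hlk' := hkl.ne'
  by_cases h1 : i = k <;> by_cases h2 : j = l <;> by_cases h3 : i = l <;> by_cases h4 : j = k <;>
    first
    | (exfalso; omega)
    | (simp only [h1, h2, h3, h4, hkl', hlk', if_true, if_false, and_true, and_false, and_self]
       ring)

/-- `w_α` and `v_α` as elements of `𝕊`. -/
def wS {n : ℕ} (α : Idx n) : SMat n := ⟨w α, w_mem α⟩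

noncomputable def vS {n : ℕ} (α : Idx n) : SMat n := ⟨v α, v_mem α⟩

/-- The sampling operator `R_Ω = ∑_{α ∈ Ω} ⟨·, w_α⟩ v_α : 𝕊 → 𝕊`, where `Ω` is a list of `m`
indices, repetitions being counted. -/
noncomputable def sampling {n m : ℕ} (Ω : Fin m → Idx n) : SMat n →L[ℝ] SMat n :=
  ∑ k, (innerSL ℝ (wS (Ω k))).smulRight (vS (Ω k))

/-- A ground truth matrix `X ∈ 𝕊` of rank `r` together with a thin spectral decomposition
`X = U D Uᵀ`, `U` an `n × r` matrix with orthonormal columns and `D` diagonal. -/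
structure GroundTruth (n r : ℕ) where
  X : Matrix (Fin n) (Fin n) ℝ
  U : Matrix (Fin n) (Fin r) ℝ
  D : Fin r → ℝ
  mem : X ∈ centeredSymm n
  rank_eq : X.rank = r
  orth : Uᵀ * U = 1
  decomp : X = U * Matrix.diagonal D * Uᵀ

namespace GroundTruth

variable {n r : ℕ} (G : GroundTruth n r)

/-- The orthogonal projection `P_U = U Uᵀ` onto the column space of `X`. -/
def PU : Matrix (Fin n) (Fin n) ℝ := G.U * G.Uᵀ

/-- `P_𝕋 Y = P_U Y + Y P_U - P_U Y P_U`, for an arbitrary `n × n` matrix `Y`. -/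
def PT : Matrix (Fin n) (Fin n) ℝ →ₗ[ℝ] Matrix (Fin n) (Fin n) ℝ where
  toFun Y := G.PU * Y + Y * G.PU - G.PU * Y * G.PU
  map_add' A B := by
    simp only [Matrix.mul_add, Matrix.add_mul]
    abel
  map_smul' c A := by
    simp only [Matrix.mul_smul, Matrix.smul_mul, RingHom.id_apply, smul_sub, smul_add]

theorem D_ne_zero (i : Fin r) : G.D i ≠ 0 := by
  have h1 : r ≤ (Matrix.diagonal G.D).rank := by
    conv_lhs => rw [← G.rank_eq, G.decomp]
    exact (Matrix.rank_mul_le_left _ _).trans (Matrix.rank_mul_le_right _ _)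
  rw [Matrix.rank_diagonal] at h1
  intro hi
  have h2 := Fintype.card_subtype_lt (p := fun j => G.D j ≠ 0) (x := i) (by simpa using hi)
  simp only [Fintype.card_fin] at h2
  omega

theorem PU_mulVec_one : G.PU *ᵥ 1 = 0 := by
  have h : G.Uᵀ *ᵥ (G.X *ᵥ 1) = 0 := by rw [G.mem.2, Matrix.mulVec_zero]
  rw [G.decomp, Matrix.mulVec_mulVec, ← Matrix.mul_assoc, ← Matrix.mul_assoc, G.orth,
    Matrix.one_mul, ← Matrix.mulVec_mulVec] at h
  have h' : G.Uᵀ *ᵥ 1 = 0 := by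
    ext i
    have hi := congrFun h i
    rw [Matrix.mulVec_diagonal] at hi
    exact (mul_eq_zero.mp hi).resolve_left (G.D_ne_zero i)
  rw [PU, ← Matrix.mulVec_mulVec, h', Matrix.mulVec_zero]

theorem PT_mem {Y : Matrix (Fin n) (Fin n) ℝ} (hY : Y ∈ centeredSymm n) :
    G.PT Y ∈ centeredSymm n := by
  have hP : G.PUᵀ = G.PU := by simp [PU]
  constructor
  · simp only [PT, LinearMap.coe_mk, AddHom.coe_mk, Matrix.transpose_sub, Matrix.transpose_add,
      Matrix.transpose_mul, hP, hY.1, Matrix.mul_assoc]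
    abel
  · simp only [PT, LinearMap.coe_mk, AddHom.coe_mk, Matrix.sub_mulVec, Matrix.add_mulVec,
      ← Matrix.mulVec_mulVec, hY.2, G.PU_mulVec_one, Matrix.mulVec_zero, add_zero, sub_zero]

/-- `P_𝕋` as an operator on `𝕊`. -/
noncomputable def PTS : SMat n →L[ℝ] SMat n :=
  LinearMap.toContinuousLinearMap (E := SMat n) (F' := SMat n)
    (G.PT.restrict (p := centeredSymm n) (q := centeredSymm n) fun _ hY => G.PT_mem hY)

/-- The incoherence assumption with parameter `ν`. -/
structure Incoherent (ν : ℝ) : Prop where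
  one_le : 1 ≤ ν
  PU_e : ∀ α : Idx n, frobNorm (G.PU * e α.1.1 α.1.2) ≤ √(ν * r / (128 * n))
  PU_w : ∀ α : Idx n, frobNorm (G.PU * w α) ≤ √(ν * r / (8 * n))
  PU_v : ∀ α : Idx n, frobNorm (G.PU * v α) ≤ √(ν * r / (2 * n))
  PT_e : ∀ α : Idx n, frobNorm (G.PT (e α.1.1 α.1.2)) ≤ √(ν * r / (128 * n))
  PT_w : ∀ α : Idx n, frobNorm (G.PT (w α)) ≤ √(ν * r / (8 * n))
  PT_v : ∀ α : Idx n, frobNorm (G.PT (v α)) ≤ √(ν * r / (2 * n))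

/-- `(L / m) ‖P_𝕋 A P_𝕋 - (m / L) P_𝕋‖` for an operator `A` on `𝕊`; the norm is the operator
norm with respect to the Frobenius norm on `𝕊`. -/
noncomputable def ripDev (m : ℕ) (A : SMat n →L[ℝ] SMat n) : ℝ :=
  numIdx n / m * ‖G.PTS ∘L A ∘L G.PTS - ((m : ℝ) / numIdx n) • G.PTS‖

end GroundTruth

end EDG

/-! Each sample contributes the centred operator `Z_α = P_𝕋(⟨·, w_α⟩ v_α)P_𝕋 - L⁻¹ P_𝕋`.
Bi-orthogonality of `w` and `v` gives `∑_α Z_α = 0`, and the sum of the `Z_{α_k}` is exactly the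
deviation to be bounded. A matrix Bernstein inequality (`card_lt_norm_sum_le`) then needs a uniform
bound `‖Z_α‖ ≤ νr/(2n)` and second-moment bounds `(νr)²/(2nL)` for `Z_α` and its adjoint.

The delicate moment is the one needing `∑_α ⟨w_α, P_𝕋 Y⟩² ≤ νr ‖Y‖²` (`sum_inner_wS_PTS_sq_le`). The
estimate for general `Y` costs a factor `n`, but only on diagonal entries; for `P_𝕋 Y` these are
controlled by the diagonal of `P_U`, which incoherence makes of order `νr/n`. The `v`-moment is
bounded by `‖Y‖²` outright.

Bernstein follows the Ahlswede–Winter route: dilate to symmetric matrices, bound the trace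
exponential by iterating Golden–Thompson (Lie product formula plus a trace Hölder inequality), and
apply Markov. Uniform samples from a finite set allow everything to be done by counting sequences.
Since `P_𝕋` is self-adjoint, `R_Ω` and its adjoint have the same deviation, so one tail bound serves
both. -/

/-! ### Lie product formula. -/

section LieProduct

open Filter Topology

theorem norm_pow_sub_pow_le_mul {R : Type*} [NormedRing R] [NormOneClass R] {a b : R} {M : ℝ}
    (hM : 1 ≤ M) (ha : ‖a‖ ≤ M) (hb : ‖b‖ ≤ M) (N : ℕ) :
    ‖a ^ N - b ^ N‖ ≤ N * M ^ N * ‖a - b‖ := by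
  induction N with
  | zero => simp
  | succ N ih =>
    have hM0 : 0 ≤ M := zero_le_one.trans hM
    have h : a ^ (N + 1) - b ^ (N + 1) = a ^ N * (a - b) + (a ^ N - b ^ N) * b := by
      rw [pow_succ, pow_succ]; noncomm_ring
    have h1 : ‖a ^ N * (a - b)‖ ≤ M ^ (N + 1) * ‖a - b‖ := by
      refine (norm_mul_le _ _).trans (mul_le_mul_of_nonneg_right ?_ (norm_nonneg _))
      exact (norm_pow_le a N).trans ((pow_le_pow_left₀ (norm_nonneg _) ha N).trans
        (pow_le_pow_right₀ hM N.le_succ))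
    have h2 : ‖(a ^ N - b ^ N) * b‖ ≤ N * M ^ N * ‖a - b‖ * M :=
      (norm_mul_le _ _).trans (mul_le_mul ih hb (norm_nonneg _) (by positivity))
    rw [h]
    refine (norm_add_le _ _).trans ((add_le_add h1 h2).trans (le_of_eq ?_))
    push_cast
    ring

theorem norm_exp_le_exp_norm {𝔸 : Type*} [NormedRing 𝔸] [NormedAlgebra ℝ 𝔸] [NormOneClass 𝔸]
    (x : 𝔸) : ‖NormedSpace.exp x‖ ≤ Real.exp ‖x‖ := by
  rw [Real.exp_eq_exp_ℝ, NormedSpace.exp_eq_tsum ℝ, NormedSpace.exp_eq_tsum ℝ]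
  refine tsum_of_norm_bounded (NormedSpace.expSeries_summable' (𝕂 := ℝ) ‖x‖).hasSum fun n => ?_
  rw [norm_smul, Real.norm_of_nonneg (by positivity), smul_eq_mul]
  exact mul_le_mul_of_nonneg_left (norm_pow_le x n) (by positivity)

/-- The **Lie product formula** in a real Banach algebra. -/
theorem tendsto_exp_mul_exp_pow {𝔸 : Type*} [NormedRing 𝔸] [NormedAlgebra ℝ 𝔸]
    [CompleteSpace 𝔸] [NormOneClass 𝔸] (X Y : 𝔸) :
    Tendsto (fun N : ℕ => (NormedSpace.exp ((N : ℝ)⁻¹ • X) * NormedSpace.exp ((N : ℝ)⁻¹ • Y)) ^ N)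
      atTop (𝓝 (NormedSpace.exp (X + Y))) := by
  set g : ℝ → 𝔸 := fun s => NormedSpace.exp (s • X) * NormedSpace.exp (s • Y) -
    NormedSpace.exp (s • (X + Y)) with hg
  have hd : HasDerivAt g 0 0 := by
    have hX := hasDerivAt_exp_smul_const (𝕂 := ℝ) X 0
    have hY := hasDerivAt_exp_smul_const (𝕂 := ℝ) Y 0
    have hXY := hasDerivAt_exp_smul_const (𝕂 := ℝ) (X + Y) 0
    have h : HasDerivAt g _ 0 := (hX.mul hY).sub hXY
    convert h using 1
    simp
  have hg0 : g 0 = 0 := by simp [hg]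
  set c := ‖X‖ + ‖Y‖
  have hc : 0 ≤ c := by positivity
  -- The two one-step factors agree to first order, so their difference `g (1/N)` is `o(1/N)`.
  -- Telescoping the `N`-th powers costs a factor `N` times `exp (c/N) ^ N = exp c`, which is
  -- bounded.
  have hlim : Tendsto (fun N : ℕ => (N : ℝ) * ‖g (N : ℝ)⁻¹‖) atTop (𝓝 0) := by
    have h1 := hd.tendsto_slope_zero
    have h2 : Tendsto (fun N : ℕ => (N : ℝ)⁻¹) atTop (𝓝[≠] 0) := by
      refine tendsto_nhdsWithin_iff.mpr ⟨tendsto_inv_atTop_nhds_zero_nat, ?_⟩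
      filter_upwards [eventually_gt_atTop 0] with N hN
      simpa using hN.ne'
    have h3 := (h1.comp h2).norm
    simpa [Function.comp_def, hg0, norm_smul] using h3
  rw [tendsto_iff_norm_sub_tendsto_zero]
  refine squeeze_zero' (.of_forall fun _ => norm_nonneg _) ?_
    (by simpa using hlim.const_mul (Real.exp c))
  filter_upwards [eventually_gt_atTop 0] with N hN
  have hN' : (0 : ℝ) < N := by exact_mod_cast hN
  have hXY : NormedSpace.exp (X + Y) = NormedSpace.exp ((N : ℝ)⁻¹ • (X + Y)) ^ N := by
    let _ : NormedAlgebra ℚ 𝔸 := NormedAlgebra.restrictScalars ℚ ℝ 𝔸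
    rw [← NormedSpace.exp_nsmul, ← Nat.cast_smul_eq_nsmul ℝ, smul_smul, mul_inv_cancel₀ hN'.ne',
      one_smul]
  have hs : ‖(N : ℝ)⁻¹‖ = (N : ℝ)⁻¹ := Real.norm_of_nonneg (by positivity)
  have ha : ‖NormedSpace.exp ((N : ℝ)⁻¹ • X) * NormedSpace.exp ((N : ℝ)⁻¹ • Y)‖ ≤
      Real.exp ((N : ℝ)⁻¹ * c) := by
    refine (norm_mul_le _ _).trans ((mul_le_mul (norm_exp_le_exp_norm _) (norm_exp_le_exp_norm _)
      (norm_nonneg _) (Real.exp_pos _).le).trans (le_of_eq ?_))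
    rw [← Real.exp_add, norm_smul, norm_smul, hs, mul_add]
  have hb : ‖NormedSpace.exp ((N : ℝ)⁻¹ • (X + Y))‖ ≤ Real.exp ((N : ℝ)⁻¹ * c) := by
    refine (norm_exp_le_exp_norm _).trans (Real.exp_le_exp.mpr ?_)
    rw [norm_smul, hs]
    exact mul_le_mul_of_nonneg_left (norm_add_le _ _) (by positivity)
  have := norm_pow_sub_pow_le_mul (Real.one_le_exp (by positivity)) ha hb N
  rw [← Real.exp_nat_mul, mul_inv_cancel_left₀ hN'.ne'] at this
  rw [hXY]
  exact this.trans (le_of_eq (by ring))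

end LieProduct

/-! ### Trace Hölder and Golden–Thompson inequalities. -/

section GoldenThompson

open Filter

variable {κ : Type*} [Fintype κ]

theorem prod_map_range_two_mul {M : Type*} [Monoid M] (f : ℕ → M) (N : ℕ) :
    ((List.range (2 * N)).map f).prod =
      ((List.range N).map fun i => f (2 * i) * f (2 * i + 1)).prod := by
  induction N with
  | zero => simp
  | succ N ih =>
    rw [show 2 * (N + 1) = 2 * N + 1 + 1 by ring, List.prod_range_succ, List.prod_range_succ, ih,
      List.prod_range_succ, mul_assoc]

/-- Entrywise AM–GM. The arithmetic mean suffices because the Hölder inequality below bounds all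
factors by one common constant. -/
theorem Matrix.abs_trace_mul_le (A B : Matrix κ κ ℝ) :
    |trace (A * B)| ≤ (trace (A * Aᵀ) + trace (B * Bᵀ)) / 2 := by
  have hB : trace (B * Bᵀ) = ∑ i, ∑ j, B j i ^ 2 := by
    rw [trace_mul_comm]; simp [trace, mul_apply, sq]
  have hA : trace (A * Aᵀ) = ∑ i, ∑ j, A i j ^ 2 := by simp [trace, mul_apply, sq]
  have hAB : trace (A * B) = ∑ i, ∑ j, A i j * B j i := by simp [trace, mul_apply]
  rw [hA, hB, hAB, ← Finset.sum_add_distrib, Finset.sum_div]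
  refine (Finset.abs_sum_le_sum_abs _ _).trans (Finset.sum_le_sum fun i _ => ?_)
  rw [← Finset.sum_add_distrib, Finset.sum_div]
  refine (Finset.abs_sum_le_sum_abs _ _).trans (Finset.sum_le_sum fun j _ => ?_)
  rw [abs_le]
  constructor <;> nlinarith [sq_nonneg (A i j - B j i), sq_nonneg (A i j + B j i)]

variable [DecidableEq κ]

theorem Matrix.trace_mul_pow_comm (A B : Matrix κ κ ℝ) (N : ℕ) :
    trace ((A * B) ^ N) = trace ((B * A) ^ N) := by
  cases N with
  | zero => simp
  | succ N =>
    have h : (A * B) ^ N * A = A * (B * A) ^ N := by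
      induction N with
      | zero => simp
      | succ N ih => rw [pow_succ', mul_assoc, ih, pow_succ']; simp only [mul_assoc]
    rw [pow_succ, ← mul_assoc, h, mul_assoc, trace_mul_comm, mul_assoc, ← pow_succ]

/-- A Hölder inequality for the trace of a product of `2 ^ (k + 1)` matrices. -/
theorem Matrix.abs_trace_prod_le (k : ℕ) (C : ℝ) (f : ℕ → Matrix κ κ ℝ)
    (hf : ∀ i, trace ((f i * (f i)ᵀ) ^ 2 ^ k) ≤ C) :
    |trace ((List.range (2 ^ (k + 1))).map f).prod| ≤ C := by
  induction k generalizing f with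
  | zero =>
    have h0 := hf 0
    have h1 := hf 1
    simp only [pow_zero, pow_one] at h0 h1
    have : ((List.range (2 ^ (0 + 1))).map f).prod = f 0 * f 1 := by
      simp [List.range_succ]
    rw [this]
    exact (abs_trace_mul_le _ _).trans (by linarith)
  | succ k ih =>
    rw [pow_succ', prod_map_range_two_mul]
    -- Neighbouring factors are paired. The hypothesis for a pair `X * Z` is a second use of
    -- induction: up to cyclic order, the trace of `(XZ(XZ)ᵀ) ^ 2 ^ k` is that of an alternating
    -- product of `XᵀX` and `ZZᵀ` with `2 ^ (k + 1)` factors.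
    refine ih _ fun i => ?_
    set X := f (2 * i)
    set Z := f (2 * i + 1)
    have hX : trace ((X * Xᵀ) ^ 2 ^ (k + 1)) ≤ C := hf _
    have hZ : trace ((Z * Zᵀ) ^ 2 ^ (k + 1)) ≤ C := hf _
    have h := ih (fun j => if j % 2 = 0 then Xᵀ * X else Z * Zᵀ) fun j => by
      have key : ∀ A : Matrix κ κ ℝ, (A * A) ^ 2 ^ k = A ^ 2 ^ (k + 1) := fun A => by
        rw [← sq, ← pow_mul, pow_succ']
      by_cases hj : j % 2 = 0
      · simp only [hj, if_true, transpose_mul, transpose_transpose]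
        rw [key, trace_mul_pow_comm]
        exact hX
      · simp only [hj, if_false, transpose_mul, transpose_transpose]
        rw [key]
        exact hZ
    rw [pow_succ', prod_map_range_two_mul] at h
    have h2 : ((List.range (2 ^ k)).map fun j => (if (2 * j) % 2 = 0 then Xᵀ * X else Z * Zᵀ) *
        (if (2 * j + 1) % 2 = 0 then Xᵀ * X else Z * Zᵀ)).prod = (Xᵀ * X * (Z * Zᵀ)) ^ 2 ^ k := by
      have : ∀ j, (2 * j + 1) % 2 = 1 := fun j => by omega
      simp [this]
    rw [h2] at h
    rw [transpose_mul, show X * Z * (Zᵀ * Xᵀ) = X * (Z * Zᵀ * Xᵀ) by simp only [mul_assoc],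
      trace_mul_pow_comm, show Z * Zᵀ * Xᵀ * X = (Z * Zᵀ) * (Xᵀ * X) by simp only [mul_assoc],
      trace_mul_pow_comm]
    exact (le_abs_self _).trans h

/-- Hölder with all factors equal to `AB` passes to `(AB²A) ^ 2 ^ k`, cyclically `(A²B²) ^ 2 ^ k`;
induction then applies to `A²`, `B²`. -/
theorem Matrix.trace_mul_pow_two_pow_le {A B : Matrix κ κ ℝ} (hA : A.IsSymm) (hB : B.IsSymm)
    (k : ℕ) : trace ((A * B) ^ 2 ^ k) ≤ trace (A ^ 2 ^ k * B ^ 2 ^ k) := by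
  induction k generalizing A B with
  | zero => simp
  | succ k ih =>
    have h := abs_trace_prod_le k (trace ((A * B * (A * B)ᵀ) ^ 2 ^ k)) (fun _ => A * B)
      fun _ => le_rfl
    have h1 : ((List.range (2 ^ (k + 1))).map fun _ => A * B).prod = (A * B) ^ 2 ^ (k + 1) := by
      simp
    rw [h1, transpose_mul, hA.eq, hB.eq, show A * B * (B * A) = A * (B ^ 2 * A) by
      rw [sq]; simp only [mul_assoc], trace_mul_pow_comm A (B ^ 2 * A), mul_assoc, ← sq,
      trace_mul_pow_comm (B ^ 2)] at h
    have := ih (hA.pow 2) (hB.pow 2)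
    rw [← pow_mul, ← pow_mul, ← pow_succ'] at this
    exact (le_abs_self _).trans (h.trans this)

/-- The **Golden–Thompson inequality** for real symmetric matrices. -/
theorem Matrix.trace_exp_add_le {A B : Matrix κ κ ℝ} (hA : A.IsSymm) (hB : B.IsSymm) :
    trace (NormedSpace.exp (A + B)) ≤ trace (NormedSpace.exp A * NormedSpace.exp B) := by
  -- The auxiliary operator norm satisfies `‖1‖ = 1` only for a nonempty index type.
  cases isEmpty_or_nonempty κ
  · simp [trace]
  let _ : NormedRing (Matrix κ κ ℝ) := Matrix.linftyOpNormedRing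
  let _ : NormedAlgebra ℝ (Matrix κ κ ℝ) := Matrix.linftyOpNormedAlgebra
  have _ : NormOneClass (Matrix κ κ ℝ) := Matrix.linfty_opNormOneClass
  have h1 := (tendsto_exp_mul_exp_pow A B).comp
    (tendsto_pow_atTop_atTop_of_one_lt (one_lt_two : 1 < (2 : ℕ)))
  have h2 : Continuous fun M : Matrix κ κ ℝ => trace M := continuous_id.matrix_trace
  refine le_of_tendsto ((h2.tendsto _).comp h1) (.of_forall fun k => ?_)
  have key : ∀ M : Matrix κ κ ℝ,
      NormedSpace.exp (((2 ^ k : ℕ) : ℝ)⁻¹ • M) ^ 2 ^ k = NormedSpace.exp M := fun M => by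
    rw [← Matrix.exp_nsmul, ← Nat.cast_smul_eq_nsmul ℝ, smul_smul, mul_inv_cancel₀ (by positivity),
      one_smul]
  have := trace_mul_pow_two_pow_le (hA.smul ((2 ^ k : ℕ) : ℝ)⁻¹).exp
    (hB.smul ((2 ^ k : ℕ) : ℝ)⁻¹).exp k
  rw [key, key] at this
  exact this

end GoldenThompson

/-! ### Spectral bounds for exponentials of symmetric matrices. -/

section SymmetricExp

variable {κ : Type*} [Fintype κ] [DecidableEq κ]

theorem Matrix.IsSymm.exists_diagonalization {S : Matrix κ κ ℝ} (hS : S.IsSymm) :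
    ∃ (Q : Matrix κ κ ℝ) (l : κ → ℝ), Q * Qᵀ = 1 ∧ Qᵀ * Q = 1 ∧ S = Q * diagonal l * Qᵀ ∧
      NormedSpace.exp S = Q * diagonal (fun i => Real.exp (l i)) * Qᵀ := by
  have hH : S.IsHermitian := by
    rw [Matrix.IsHermitian, conjTranspose_eq_transpose_of_trivial, hS.eq]
  set Q : Matrix κ κ ℝ := (hH.eigenvectorUnitary : Matrix κ κ ℝ) with hQ
  have hst : star Q = Qᵀ := by
    rw [star_eq_conjTranspose, conjTranspose_eq_transpose_of_trivial]
  have h1 : Q * Qᵀ = 1 := by rw [← hst]; exact Unitary.coe_mul_star_self _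
  have h2 : Qᵀ * Q = 1 := by rw [← hst]; exact Unitary.coe_star_mul_self _
  have h3 : S = Q * diagonal hH.eigenvalues * Qᵀ := by
    conv_lhs => rw [hH.spectral_theorem, Unitary.conjStarAlgAut_apply]
    rw [← hst]
    rfl
  refine ⟨Q, hH.eigenvalues, h1, h2, h3, ?_⟩
  have hu : IsUnit Q := IsUnit.of_mul_eq_one _ h1
  have hinv : Q⁻¹ = Qᵀ := inv_eq_right_inv h1
  conv_lhs => rw [h3, ← hinv, Matrix.exp_conj _ _ hu, hinv, Matrix.exp_diagonal]
  congr 3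
  ext i
  rw [Pi.coe_exp, Real.exp_eq_exp_ℝ]

theorem Matrix.trace_conj_diagonal {Q : Matrix κ κ ℝ} (hQ : Qᵀ * Q = 1) (l : κ → ℝ) :
    trace (Q * diagonal l * Qᵀ) = ∑ i, l i := by
  rw [trace_mul_comm, ← mul_assoc, hQ, one_mul, trace_diagonal]

/-- The exponential of a symmetric contraction is dominated by its quadratic Taylor bound. -/
theorem Matrix.IsSymm.posSemidef_one_add_self_add_sq_sub_exp {S : Matrix κ κ ℝ} (hS : S.IsSymm)
    (h : ∀ x, (S *ᵥ x) ⬝ᵥ (S *ᵥ x) ≤ x ⬝ᵥ x) :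
    (1 + S + S * S - NormedSpace.exp S).PosSemidef := by
  obtain ⟨Q, l, h1, h2, h3, h4⟩ := hS.exists_diagonalization
  have hl : ∀ i, |l i| ≤ 1 := fun i => by
    have hSx : S *ᵥ (Q *ᵥ Pi.single i 1) = l i • (Q *ᵥ Pi.single i 1) := by
      rw [h3, mulVec_mulVec, mul_assoc, h2, mul_one, ← mulVec_mulVec, diagonal_mulVec_single,
        ← mulVec_smul]
      congr 1
      ext j
      simp [Pi.single_apply]
    have hx : (Q *ᵥ Pi.single i 1) ⬝ᵥ (Q *ᵥ Pi.single i (1 : ℝ)) = 1 := by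
      rw [dotProduct_mulVec, vecMul_mulVec, ← mulVec_transpose, transpose_mul, transpose_transpose,
        h2, one_mulVec]
      simp
    have := h (Q *ᵥ Pi.single i 1)
    rw [hSx, smul_dotProduct, dotProduct_smul, hx, smul_eq_mul, smul_eq_mul, mul_one] at this
    exact abs_le_one_iff_mul_self_le_one.mpr this
  have hdiag : 1 + S + S * S - NormedSpace.exp S =
      Q * diagonal (fun i => 1 + l i + l i * l i - Real.exp (l i)) * Qᴴ := by
    have hSS : S * S = Q * diagonal (fun i => l i * l i) * Qᵀ := by
      rw [h3, ← diagonal_mul_diagonal]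
      calc Q * diagonal l * Qᵀ * (Q * diagonal l * Qᵀ)
          = Q * diagonal l * (Qᵀ * Q) * diagonal l * Qᵀ := by simp only [mul_assoc]
        _ = _ := by rw [h2]; simp only [mul_assoc, one_mul]
    have hone : (1 : Matrix κ κ ℝ) = Q * diagonal (fun _ => 1) * Qᵀ := by
      rw [diagonal_one, mul_one, h1]
    rw [hSS, h4, conjTranspose_eq_transpose_of_trivial]
    conv_lhs => rw [hone, h3]
    rw [← add_mul, ← add_mul, ← sub_mul, ← mul_add, ← mul_add, ← mul_sub, diagonal_add,
      diagonal_add, diagonal_sub]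
  rw [hdiag]
  refine PosSemidef.mul_mul_conjTranspose_same (PosSemidef.diagonal fun i => ?_) Q
  -- The scalar inequality `exp x ≤ 1 + x + x²` for `|x| ≤ 1`, applied to each eigenvalue.
  have := (abs_le.mp (Real.norm_exp_sub_one_sub_id_le (x := l i) (hl i))).2
  rw [Real.norm_eq_abs, sq_abs] at this
  simp only [Pi.zero_apply]
  nlinarith

/-- In an eigenbasis the quadratic form averages the eigenvalues with weights `y i ^ 2`. Jensen
moves `exp` inside, and the weights, being at most one, are dropped. -/
theorem Matrix.IsSymm.exp_dotProduct_le_trace_exp {S : Matrix κ κ ℝ} (hS : S.IsSymm) {z : κ → ℝ}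
    (hz : z ⬝ᵥ z = 1) : Real.exp (z ⬝ᵥ S *ᵥ z) ≤ trace (NormedSpace.exp S) := by
  obtain ⟨Q, l, h1, h2, h3, h4⟩ := hS.exists_diagonalization
  set y := Qᵀ *ᵥ z with hy
  have hyz : ∀ u, z ⬝ᵥ Q *ᵥ u = y ⬝ᵥ u := fun u => by
    rw [dotProduct_mulVec, hy, mulVec_transpose]
  have hy1 : ∑ i, y i * y i = 1 := by
    have : y ⬝ᵥ y = 1 := by rw [← hyz, hy, mulVec_mulVec, h1, one_mulVec, hz]
    exact this
  have hq : z ⬝ᵥ S *ᵥ z = ∑ i, (y i * y i) • l i := by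
    rw [h3, mul_assoc, ← mulVec_mulVec, hyz, ← mulVec_mulVec, ← hy]
    refine Finset.sum_congr rfl fun i _ => ?_
    rw [mulVec_diagonal, smul_eq_mul]
    ring
  rw [hq, h4, trace_conj_diagonal h2]
  refine (convexOn_exp.map_sum_le (fun i _ => mul_self_nonneg _) hy1
    fun _ _ => Set.mem_univ _).trans (Finset.sum_le_sum fun i _ => ?_)
  have : y i * y i ≤ 1 := by
    rw [← hy1]
    exact Finset.single_le_sum (f := fun i => y i * y i) (fun i _ => mul_self_nonneg _)
      (Finset.mem_univ i)
  exact mul_le_of_le_one_left (Real.exp_pos _).le this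

/-- Split `exp H` into two halves `exp (H/2)` and cycle one around: the trace is that of a
congruence of `M`. -/
theorem Matrix.IsSymm.trace_exp_mul_nonneg {H M : Matrix κ κ ℝ} (hH : H.IsSymm)
    (hM : M.PosSemidef) : 0 ≤ trace (NormedSpace.exp H * M) := by
  have h : NormedSpace.exp H =
      NormedSpace.exp ((2 : ℝ)⁻¹ • H) * NormedSpace.exp ((2 : ℝ)⁻¹ • H) := by
    rw [← Matrix.exp_add_of_commute _ _ (Commute.refl _), ← add_smul]
    norm_num
  have hs : (NormedSpace.exp ((2 : ℝ)⁻¹ • H))ᴴ = NormedSpace.exp ((2 : ℝ)⁻¹ • H) := by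
    rw [conjTranspose_eq_transpose_of_trivial, (hH.smul _).exp.eq]
  have := (hM.mul_mul_conjTranspose_same (NormedSpace.exp ((2 : ℝ)⁻¹ • H))).trace_nonneg
  rwa [hs, mul_assoc, trace_mul_comm, mul_assoc, ← h, trace_mul_comm] at this

/-- Iterated Golden–Thompson bound for the exponential moment of a sum of independent samples from
a finite family of symmetric matrices. -/
theorem Matrix.sum_trace_exp_add_sum_le {ι : Type*} [Fintype ι] {S : ι → Matrix κ κ ℝ}
    (hS : ∀ a, (S a).IsSymm) {K : ℝ} (hK0 : 0 ≤ K)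
    (hK : (K • 1 - ∑ a, NormedSpace.exp (S a)).PosSemidef) (m : ℕ) {H : Matrix κ κ ℝ}
    (hH : H.IsSymm) :
    ∑ ω : Fin m → ι, trace (NormedSpace.exp (H + ∑ k, S (ω k))) ≤
      K ^ m * trace (NormedSpace.exp H) := by
  -- `H` varies so that the first sample can be absorbed into it.
  induction m generalizing H with
  | zero => simp
  | succ m ih =>
    rw [← (Fin.consEquiv fun _ : Fin (m + 1) => ι).sum_comp, Fintype.sum_prod_type]
    calc ∑ a, ∑ ω : Fin m → ι, trace (NormedSpace.exp
            (H + ∑ k, S ((Fin.consEquiv fun _ : Fin (m + 1) => ι) (a, ω) k)))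
        = ∑ a, ∑ ω : Fin m → ι, trace (NormedSpace.exp ((H + S a) + ∑ k, S (ω k))) := by
          simp [Fin.consEquiv, Fin.sum_univ_succ, add_assoc]
      _ ≤ ∑ a, K ^ m * trace (NormedSpace.exp (H + S a)) :=
          Finset.sum_le_sum fun a _ => ih (hH.add (hS a))
      _ ≤ ∑ a, K ^ m * trace (NormedSpace.exp H * NormedSpace.exp (S a)) :=
          Finset.sum_le_sum fun a _ =>
            mul_le_mul_of_nonneg_left (trace_exp_add_le hH (hS a)) (by positivity)
      _ = K ^ m * trace (NormedSpace.exp H * ∑ a, NormedSpace.exp (S a)) := by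
          rw [← Finset.mul_sum, Matrix.mul_sum, trace_sum]
      _ ≤ K ^ m * (K * trace (NormedSpace.exp H)) := by
          refine mul_le_mul_of_nonneg_left ?_ (by positivity)
          have := hH.trace_exp_mul_nonneg hK
          rw [mul_sub, trace_sub, Matrix.mul_smul, mul_one, trace_smul, smul_eq_mul] at this
          linarith
      _ = K ^ (m + 1) * trace (NormedSpace.exp H) := by ring

end SymmetricExp

/-! ### Self-adjoint dilation of an operator. -/

section Dilation

variable {κ E : Type*} [Fintype κ] [NormedAddCommGroup E] [InnerProductSpace ℝ E]

/-- The coordinates of a pair of vectors, to which a dilation matrix applies. -/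
noncomputable def pairCoords (b : OrthonormalBasis κ ℝ E) (u v : E) : κ ⊕ κ → ℝ :=
  Sum.elim (fun i => b.repr u i) (fun i => b.repr v i)

variable (b : OrthonormalBasis κ ℝ E)

theorem exists_pairCoords_eq (z : κ ⊕ κ → ℝ) : ∃ u v, z = pairCoords b u v := by
  refine ⟨b.repr.symm (WithLp.toLp 2 fun i => z (.inl i)),
    b.repr.symm (WithLp.toLp 2 fun i => z (.inr i)), ?_⟩
  ext i
  cases i <;> simp [pairCoords]

theorem pairCoords_dotProduct (u v u' v' : E) :
    pairCoords b u v ⬝ᵥ pairCoords b u' v' = inner ℝ u u' + inner ℝ v v' := by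
  have h : ∀ x y : E, ∑ i, b.repr x i * b.repr y i = inner ℝ x y := fun x y => by
    rw [← b.repr.inner_map_map x y, PiLp.inner_apply]
    simp [mul_comm]
  rw [← h, ← h]
  simp [dotProduct, pairCoords, Fintype.sum_sum_type]

variable [DecidableEq κ]

/-- The matrix, in an orthonormal basis, of the self-adjoint dilation of an operator. -/
noncomputable def dilationMatrix (A : E →L[ℝ] E) :
    Matrix (κ ⊕ κ) (κ ⊕ κ) ℝ :=
  fromBlocks 0 (LinearMap.toMatrix b.toBasis b.toBasis (A : E →ₗ[ℝ] E))
    (LinearMap.toMatrix b.toBasis b.toBasis (A : E →ₗ[ℝ] E))ᵀ 0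

theorem dilationMatrix_isSymm (A : E →L[ℝ] E) : (dilationMatrix b A).IsSymm := by
  rw [dilationMatrix, IsSymm, fromBlocks_transpose]
  simp

theorem dilationMatrix_smul (c : ℝ) (A : E →L[ℝ] E) :
    dilationMatrix b (c • A) = c • dilationMatrix b A := by
  simp [dilationMatrix, fromBlocks_smul]

theorem dilationMatrix_sum {ι : Type*} (s : Finset ι) (A : ι → E →L[ℝ] E) :
    dilationMatrix b (∑ a ∈ s, A a) = ∑ a ∈ s, dilationMatrix b (A a) := by
  classical
  induction s using Finset.induction_on with
  | empty => simp [dilationMatrix]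
  | insert a s ha ih =>
    rw [Finset.sum_insert ha, Finset.sum_insert ha, ← ih]
    simp [dilationMatrix, fromBlocks_add]

theorem dilationMatrix_mulVec [CompleteSpace E] (A : E →L[ℝ] E) (u v : E) :
    dilationMatrix b A *ᵥ pairCoords b u v =
      pairCoords b (A v) (ContinuousLinearMap.adjoint A u) := by
  have h : ∀ (B : E →L[ℝ] E) (x : E),
      LinearMap.toMatrix b.toBasis b.toBasis (B : E →ₗ[ℝ] E) *ᵥ (fun i => b.repr x i) =
        fun i => b.repr (B x) i := fun B x => by
    have := LinearMap.toMatrix_mulVec_repr b.toBasis b.toBasis (B : E →ₗ[ℝ] E) x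
    have hc : (fun i => b.repr x i) = b.toBasis.repr x := by ext i; simp
    rw [hc, this]
    ext i
    simp
  have ht : (LinearMap.toMatrix b.toBasis b.toBasis (A : E →ₗ[ℝ] E))ᵀ =
      LinearMap.toMatrix b.toBasis b.toBasis
        ((ContinuousLinearMap.adjoint A : E →L[ℝ] E) : E →ₗ[ℝ] E) := by
    ext i j
    simp only [transpose_apply, LinearMap.toMatrix_apply, OrthonormalBasis.coe_toBasis,
      OrthonormalBasis.coe_toBasis_repr_apply, b.repr_apply_apply, ContinuousLinearMap.coe_coe]
    rw [ContinuousLinearMap.adjoint_inner_right, real_inner_comm]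
  rw [dilationMatrix, pairCoords, fromBlocks_mulVec, ht]
  simp only [Sum.elim_comp_inl, Sum.elim_comp_inr, zero_mulVec, zero_add, add_zero, h]
  rfl

/-- If `‖A x‖ > t ‖x‖`, pair the normalisations of `A x` and `x`, each scaled by `1/√2`. On this
unit vector the dilation has quadratic form `‖A x‖ / ‖x‖`. -/
theorem exp_mul_le_trace_exp_dilationMatrix [CompleteSpace E] {A : E →L[ℝ] E} {t : ℝ} (ht : 0 ≤ t)
    (hA : t < ‖A‖) {θ : ℝ} (hθ : 0 ≤ θ) :
    Real.exp (θ * t) ≤ trace (NormedSpace.exp (dilationMatrix b (θ • A))) := by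
  obtain ⟨x, hx⟩ : ∃ x, t * ‖x‖ < ‖A x‖ := by
    by_contra! h
    exact absurd (A.opNorm_le_bound ht h) (not_le.mpr hA)
  have hAx : 0 < ‖A x‖ := (by positivity : 0 ≤ t * ‖x‖).trans_lt hx
  have hx0 : 0 < ‖x‖ := norm_pos_iff.mpr fun h => by simp [h] at hAx
  set u : E := (√2 * ‖A x‖)⁻¹ • A x
  set v : E := (√2 * ‖x‖)⁻¹ • x
  have h2 : √2 * √2 = 2 := Real.mul_self_sqrt zero_le_two
  have hone : ∀ y : E, 0 < ‖y‖ →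
      inner ℝ ((√2 * ‖y‖)⁻¹ • y) ((√2 * ‖y‖)⁻¹ • y) = (1 / 2 : ℝ) := fun y hy => by
    rw [inner_smul_left, inner_smul_right, real_inner_self_eq_norm_mul_norm, RCLike.conj_to_real]
    field_simp
    nlinarith
  have hz : pairCoords b u v ⬝ᵥ pairCoords b u v = 1 := by
    rw [pairCoords_dotProduct, hone _ hAx, hone _ hx0]
    norm_num
  refine le_trans (Real.exp_le_exp.mpr ?_)
    ((dilationMatrix_isSymm b (θ • A)).exp_dotProduct_le_trace_exp hz)
  rw [dilationMatrix_smul, smul_mulVec, dotProduct_smul, smul_eq_mul, dilationMatrix_mulVec,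
    pairCoords_dotProduct, ContinuousLinearMap.adjoint_inner_right, real_inner_comm u (A v)]
  refine mul_le_mul_of_nonneg_left ?_ hθ
  have : inner ℝ u (A v) = ‖A x‖ / ‖x‖ / 2 := by
    rw [map_smul, inner_smul_left, inner_smul_right, real_inner_self_eq_norm_mul_norm,
      RCLike.conj_to_real]
    field_simp
    nlinarith
  rw [this, add_halves, le_div_iff₀ hx0]
  exact hx.le

end Dilation

/-! ### Matrix Bernstein by counting, and its transfer to probabilities. -/

/-- A **matrix Bernstein inequality**, in counting form, for sums of independent uniform samples
from a finite centred family of operators. -/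
theorem card_lt_norm_sum_le {E : Type*} [NormedAddCommGroup E] [InnerProductSpace ℝ E]
    [FiniteDimensional ℝ E] [CompleteSpace E] {ι : Type*} [Fintype ι] {A : ι → E →L[ℝ] E}
    (h0 : ∑ a, A a = 0) {R V θ t : ℝ} (hθ : 0 ≤ θ) (ht : 0 ≤ t) (hV : 0 ≤ V)
    (hR : ∀ a, ‖A a‖ ≤ R) (hθR : θ * R ≤ 1)
    (h1 : ∀ x, ∑ a, ‖A a x‖ ^ 2 ≤ Fintype.card ι * V * ‖x‖ ^ 2)
    (h2 : ∀ x, ∑ a, ‖ContinuousLinearMap.adjoint (A a) x‖ ^ 2 ≤ Fintype.card ι * V * ‖x‖ ^ 2)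
    (m : ℕ) [DecidablePred fun ω : Fin m → ι => t < ‖∑ k, A (ω k)‖] :
    ((Finset.univ.filter fun ω : Fin m → ι => t < ‖∑ k, A (ω k)‖).card : ℝ) ≤
      (Fintype.card ι : ℝ) ^ m *
        (2 * Module.finrank ℝ E * Real.exp (m * (θ ^ 2 * V) - θ * t)) := by
  set b := stdOrthonormalBasis ℝ E
  set N : ℝ := (Fintype.card ι : ℝ)
  set S : ι → Matrix _ _ ℝ := fun a => dilationMatrix b (θ • A a) with hSdef
  have hS : ∀ a, (S a).IsSymm := fun a => dilationMatrix_isSymm b _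
  have hSS : ∀ a u v, (S a *ᵥ pairCoords b u v) ⬝ᵥ (S a *ᵥ pairCoords b u v) =
      θ ^ 2 * (‖A a v‖ ^ 2 + ‖ContinuousLinearMap.adjoint (A a) u‖ ^ 2) := fun a u v => by
    rw [hSdef]
    simp only [dilationMatrix_smul, smul_mulVec, dotProduct_smul, smul_dotProduct,
      dilationMatrix_mulVec, pairCoords_dotProduct, real_inner_self_eq_norm_sq, smul_eq_mul]
    ring
  have hzz : ∀ u v, pairCoords b u v ⬝ᵥ pairCoords b u v = ‖u‖ ^ 2 + ‖v‖ ^ 2 := fun u v => by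
    rw [pairCoords_dotProduct, real_inner_self_eq_norm_sq, real_inner_self_eq_norm_sq]
  have hcontr : ∀ a x, (S a *ᵥ x) ⬝ᵥ (S a *ᵥ x) ≤ x ⬝ᵥ x := fun a x => by
    obtain ⟨u, v, rfl⟩ := exists_pairCoords_eq b x
    rw [hSS, hzz]
    have key : ∀ (B : E →L[ℝ] E) (y : E), ‖B‖ ≤ R → θ ^ 2 * ‖B y‖ ^ 2 ≤ ‖y‖ ^ 2 := fun B y hB => by
      rw [← mul_pow]
      refine pow_le_pow_left₀ (by positivity) ?_ 2
      calc θ * ‖B y‖ ≤ θ * (R * ‖y‖) := mul_le_mul_of_nonneg_left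
            ((B.le_opNorm y).trans (mul_le_mul_of_nonneg_right hB (norm_nonneg _))) hθ
        _ = θ * R * ‖y‖ := by ring
        _ ≤ 1 * ‖y‖ := mul_le_mul_of_nonneg_right hθR (norm_nonneg _)
        _ = ‖y‖ := one_mul _
    have k1 := key (A a) v (hR a)
    have k2 := key (ContinuousLinearMap.adjoint (A a)) u
      ((LinearIsometryEquiv.norm_map ContinuousLinearMap.adjoint (A a)).trans_le (hR a))
    linarith
  have hsum0 : ∑ a, S a = 0 := by
    rw [hSdef, ← dilationMatrix_sum, ← Finset.smul_sum, h0, smul_zero]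
    simp [dilationMatrix]
  -- Sum `exp S ≤ 1 + S + S²` over the family. The linear terms cancel by centring; `S²` is block
  -- diagonal with blocks `θ²AA*` and `θ²A*A`, whence the two moment hypotheses.
  have hK : ((N * (1 + θ ^ 2 * V)) • 1 - ∑ a, NormedSpace.exp (S a)).PosSemidef := by
    have hA := posSemidef_sum Finset.univ fun a _ =>
      (hS a).posSemidef_one_add_self_add_sq_sub_exp (hcontr a)
    have hB : ((N * (θ ^ 2 * V)) • 1 - ∑ a, S a * S a).PosSemidef := by
      refine PosSemidef.of_dotProduct_mulVec_nonneg ?_ fun x => ?_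
      · rw [Matrix.IsHermitian, conjTranspose_eq_transpose_of_trivial, transpose_sub,
          transpose_smul, transpose_one, transpose_sum]
        simp only [transpose_mul, (hS _).eq]
      · obtain ⟨u, v, rfl⟩ := exists_pairCoords_eq b x
        rw [star_trivial, sub_mulVec, dotProduct_sub, smul_mulVec, one_mulVec, dotProduct_smul, hzz,
          smul_eq_mul, sum_mulVec, dotProduct_sum]
        have : ∀ a, pairCoords b u v ⬝ᵥ (S a * S a) *ᵥ pairCoords b u v =
            θ ^ 2 * (‖A a v‖ ^ 2 + ‖ContinuousLinearMap.adjoint (A a) u‖ ^ 2) := fun a => by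
          rw [← hSS, ← mulVec_mulVec, dotProduct_mulVec, ← mulVec_transpose, (hS a).eq]
        simp only [this]
        rw [← Finset.mul_sum, Finset.sum_add_distrib]
        nlinarith [h1 v, h2 u, sq_nonneg θ]
    have hAB := hA.add hB
    convert hAB using 1
    rw [Finset.sum_sub_distrib, Finset.sum_add_distrib, Finset.sum_add_distrib, hsum0]
    simp only [Finset.sum_const, Finset.card_univ, ← Nat.cast_smul_eq_nsmul ℝ]
    rw [mul_add, add_smul, mul_one]
    abel
  have hN : 0 ≤ N := Nat.cast_nonneg _
  have hmgf := sum_trace_exp_add_sum_le hS (K := N * (1 + θ ^ 2 * V)) (by positivity) hK m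
    (H := 0) isSymm_zero
  have htr : trace (NormedSpace.exp (0 : Matrix
      (Fin (Module.finrank ℝ E) ⊕ Fin (Module.finrank ℝ E))
      (Fin (Module.finrank ℝ E) ⊕ Fin (Module.finrank ℝ E)) ℝ)) = 2 * Module.finrank ℝ E := by
    rw [NormedSpace.exp_zero, trace_one]
    simp
    ring
  simp only [zero_add, htr] at hmgf
  -- Markov's inequality by counting: each bad sequence contributes at least `exp (θ * t)`, every
  -- other a nonnegative trace.
  have hcard : ((Finset.univ.filter fun ω : Fin m → ι => t < ‖∑ k, A (ω k)‖).card : ℝ) *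
      Real.exp (θ * t) ≤ ∑ ω : Fin m → ι, trace (NormedSpace.exp (∑ k, S (ω k))) := by
    rw [← nsmul_eq_mul, ← Finset.sum_const]
    have hsub := Finset.sum_le_sum_of_subset_of_nonneg
      (Finset.filter_subset (fun ω : Fin m → ι => t < ‖∑ k, A (ω k)‖) Finset.univ)
      (f := fun ω => trace (NormedSpace.exp (∑ k, S (ω k)))) fun ω _ _ => by
        have hsym : (∑ k, S (ω k)).IsSymm := by
          rw [IsSymm, transpose_sum]
          simp only [(hS _).eq]
        simpa using hsym.trace_exp_mul_nonneg PosSemidef.one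
    refine le_trans (Finset.sum_le_sum fun ω hω => ?_) hsub
    have := exp_mul_le_trace_exp_dilationMatrix b ht (Finset.mem_filter.mp hω).2 hθ
    rwa [Finset.smul_sum, dilationMatrix_sum] at this
  have hpow : (N * (1 + θ ^ 2 * V)) ^ m ≤ N ^ m * Real.exp (m * (θ ^ 2 * V)) := by
    rw [mul_pow, Real.exp_nat_mul]
    gcongr
    rw [add_comm]
    exact Real.add_one_le_exp _
  rw [Real.exp_sub, ← mul_div_assoc, ← mul_div_assoc, le_div_iff₀ (Real.exp_pos _)]
  calc _ ≤ _ := hcard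
    _ ≤ _ := hmgf
    _ ≤ N ^ m * Real.exp (m * (θ ^ 2 * V)) * (2 * Module.finrank ℝ E) :=
      mul_le_mul_of_nonneg_right hpow (by positivity)
    _ = _ := by ring

/-- The probability that independent uniform samples from a finite type fall into a set of
sequences is at most the proportion of these sequences. -/
theorem measureReal_setOf_comp_le_card {S ι : Type*} [MeasurableSpace S] {μ : Measure S}
    [IsProbabilityMeasure μ] [Fintype ι] [MeasurableSpace ι] [MeasurableSingletonClass ι] {m : ℕ}
    {Ω : Fin m → S → ι} (hindep : iIndepFun Ω μ) {q : ℝ}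
    (hunif : ∀ k a, μ.real {s | Ω k s = a} = q) (B : (Fin m → ι) → Prop) [DecidablePred B] :
    μ.real {s | B fun k => Ω k s} ≤ (Finset.univ.filter B).card * q ^ m := by
  have hsub : {s | B fun k => Ω k s} ⊆
      ⋃ ω ∈ Finset.univ.filter B, ⋂ k ∈ Finset.univ, Ω k ⁻¹' {ω k} := fun s hs => by
    simp only [Set.mem_iUnion, Set.mem_iInter]
    exact ⟨fun k => Ω k s, Finset.mem_filter.mpr ⟨Finset.mem_univ _, hs⟩, fun k _ => rfl⟩
  refine (measureReal_mono hsub (measure_ne_top _ _)).trans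
    ((measureReal_biUnion_finset_le _ _).trans (le_of_eq ?_))
  rw [← nsmul_eq_mul, ← Finset.sum_const]
  refine Finset.sum_congr rfl fun ω _ => ?_
  rw [measureReal_def, hindep.measure_inter_preimage_eq_mul Finset.univ
    fun k _ => measurableSet_singleton (ω k), ENNReal.toReal_prod]
  calc ∏ k, (μ (Ω k ⁻¹' {ω k})).toReal = ∏ _k : Fin m, q :=
        Finset.prod_congr rfl fun k _ => hunif k (ω k)
    _ = q ^ m := by simp

/-- Variance is at most the second moment; this discards the centring term. -/
theorem sum_norm_sub_sq_le {E ι : Type*} [NormedAddCommGroup E] [InnerProductSpace ℝ E]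
    [Fintype ι] (a : ι → E) {c : E} (hc : ∑ i, a i = (Fintype.card ι : ℝ) • c) :
    ∑ i, ‖a i - c‖ ^ 2 ≤ ∑ i, ‖a i‖ ^ 2 := by
  have h : ∑ i, ‖a i - c‖ ^ 2 = ∑ i, ‖a i‖ ^ 2 - Fintype.card ι * ‖c‖ ^ 2 := by
    simp only [norm_sub_sq_real, Finset.sum_add_distrib, Finset.sum_sub_distrib, ← Finset.mul_sum,
      ← sum_inner, hc, inner_smul_left, real_inner_self_eq_norm_sq]
    simp
    ring
  rw [h]
  have : 0 ≤ (Fintype.card ι : ℝ) * ‖c‖ ^ 2 := by positivity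
  linarith

/-! ### Bi-orthogonal expansion and moment bounds on `𝕊`. -/

namespace EDG

section Frobenius

theorem sum_idx_eq_half {n : ℕ} (F : Fin n → Fin n → ℝ) (hF : ∀ i j, F i j = F j i)
    (hd : ∀ i, F i i = 0) : ∑ α : Idx n, F α.1.1 α.1.2 = (∑ i, ∑ j, F i j) / 2 := by
  have h1 : ∑ α : Idx n, F α.1.1 α.1.2 = ∑ i, ∑ j, if i < j then F i j else 0 := by
    rw [← Fintype.sum_prod_type' (fun i j => if i < j then F i j else 0), ← Finset.sum_filter]
    exact (Finset.sum_subtype (Finset.univ.filter fun p : Fin n × Fin n => p.1 < p.2)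
      (fun p => by simp) fun p => F p.1 p.2).symm
  have h2 : ∑ i, ∑ j, (if i < j then F i j else 0) = ∑ i, ∑ j, if j < i then F i j else 0 := by
    rw [Finset.sum_comm]
    exact Finset.sum_congr rfl fun i _ => Finset.sum_congr rfl fun j _ => by rw [hF]
  have h3 : ∑ i, ∑ j, F i j =
      (∑ i, ∑ j, if i < j then F i j else 0) + ∑ i, ∑ j, if j < i then F i j else 0 := by
    simp only [← Finset.sum_add_distrib]
    refine Finset.sum_congr rfl fun i _ => Finset.sum_congr rfl fun j _ => ?_
    rcases lt_trichotomy i j with h | rfl | h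
    · simp [h, h.not_gt]
    · simp [hd]
    · simp [h, h.not_gt]
  rw [h1, h3, ← h2]
  ring

theorem card_idx (n : ℕ) : (Fintype.card (Idx n) : ℝ) = numIdx n := by
  have h := sum_idx_eq_half (n := n) (fun i j => if i = j then 0 else 1)
    (fun i j => by simp [eq_comm]) (fun i => by simp)
  have h1 : ∑ α : Idx n, (if α.1.1 = α.1.2 then (0 : ℝ) else 1) = Fintype.card (Idx n) := by
    rw [Finset.sum_congr rfl fun α _ => if_neg α.2.ne]
    simp
  have h2 : ∑ i : Fin n, ∑ j : Fin n, (if i = j then (0 : ℝ) else 1) = n * (n - 1) := by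
    have : ∀ i j : Fin n, (if i = j then (0 : ℝ) else 1) = 1 - if i = j then 1 else 0 :=
      fun i j => by split_ifs <;> simp
    simp [this, Finset.sum_sub_distrib]
    ring
  rw [h1, h2] at h
  exact h

variable {n : ℕ}

theorem trace_transpose_mul (A B : Matrix (Fin n) (Fin n) ℝ) :
    trace (Aᵀ * B) = ∑ i, ∑ j, A i j * B i j := by
  rw [Finset.sum_comm]
  simp [trace, mul_apply]

theorem trace_transpose_mul_self_nonneg (A : Matrix (Fin n) (Fin n) ℝ) :
    0 ≤ trace (Aᵀ * A) := by
  rw [trace_transpose_mul]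
  exact Finset.sum_nonneg fun i _ => Finset.sum_nonneg fun j _ => mul_self_nonneg _

theorem trace_transpose_mul_self_le_of_frobNorm_le {A : Matrix (Fin n) (Fin n) ℝ} {c : ℝ}
    (hc : 0 ≤ c) (h : frobNorm A ≤ √c) : trace (Aᵀ * A) ≤ c :=
  (Real.sqrt_le_sqrt_iff hc).mp h

end Frobenius

namespace SMat

variable {n : ℕ}

theorem norm_eq_frobNorm (Y : SMat n) : ‖Y‖ = frobNorm (toMat Y) := by
  rw [norm_eq_sqrt_real_inner, inner_eq, frobNorm]

theorem inner_eq_sum (Y Z : SMat n) : inner ℝ Y Z = ∑ i, ∑ j, toMat Y i j * toMat Z i j := by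
  rw [inner_eq, trace_transpose_mul]

theorem norm_sq_eq_sum (Y : SMat n) : ‖Y‖ ^ 2 = ∑ i, ∑ j, toMat Y i j ^ 2 := by
  rw [← real_inner_self_eq_norm_sq, inner_eq_sum]
  simp only [sq]

theorem toMat_symm (Y : SMat n) (i j : Fin n) : toMat Y i j = toMat Y j i :=
  congrFun (congrFun (toMat_mem Y).1 j) i

theorem sum_row (Y : SMat n) (i : Fin n) : ∑ j, toMat Y i j = 0 := by
  have := congrFun (toMat_mem Y).2 i
  simpa [mulVec, dotProduct] using this

theorem finrank_le (n : ℕ) : Module.finrank ℝ (SMat n) ≤ n ^ 2 := by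
  refine (Submodule.finrank_le (centeredSymm n)).trans (le_of_eq ?_)
  rw [Module.finrank_matrix]
  simp [sq]

theorem inner_wS (α : Idx n) (Y : SMat n) : inner ℝ (wS α) Y =
    toMat Y α.1.1 α.1.1 + toMat Y α.1.2 α.1.2 - 2 * toMat Y α.1.1 α.1.2 := by
  rw [inner_eq, show toMat (wS α) = w α from rfl, (w_mem α).1]
  simp only [w, e, Matrix.sub_mul, Matrix.add_mul, Matrix.trace_sub, Matrix.trace_add,
    Matrix.trace_single_mul]
  rw [toMat_symm Y α.1.2 α.1.1]
  ring

/-- Zero row sums of `Y` make the centring of the coordinate vectors invisible. -/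
theorem inner_vS (α : Idx n) (Y : SMat n) : inner ℝ (vS α) Y = -toMat Y α.1.1 α.1.2 := by
  have h : ∀ i j, cvec i ⬝ᵥ toMat Y *ᵥ cvec j = toMat Y i j := fun i j => by
    have h0 : ∀ j, toMat Y *ᵥ cvec j = fun k => toMat Y k j := fun j => by
      ext k
      simp [cvec, mulVec, dotProduct, mul_sub, Finset.sum_sub_distrib, ← Finset.sum_mul, sum_row,
        Pi.single_apply]
    rw [h0]
    have := sum_row Y j
    simp only [toMat_symm Y j] at this
    simp [cvec, dotProduct, sub_mul, Finset.sum_sub_distrib, ← Finset.mul_sum, this,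
      Pi.single_apply]
  have ht : ∀ a b : Fin n → ℝ, trace (vecMulVec a b * toMat Y) = b ⬝ᵥ toMat Y *ᵥ a := fun a b => by
    rw [vecMulVec_mul, trace_vecMulVec, dotProduct_comm, dotProduct_mulVec]
  rw [inner_eq, show toMat (vS α) = v α from rfl, (v_mem α).1, v, Matrix.smul_mul, trace_smul,
    Matrix.add_mul, trace_add, ht, ht, h, h, toMat_symm Y α.1.2, smul_eq_mul]
  ring

/-- The expansion of the inner product in the bi-orthogonal bases `w_α` and `v_α`. -/
theorem sum_inner_wS_mul_inner_vS (Y Z : SMat n) :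
    ∑ α : Idx n, inner ℝ (wS α) Y * inner ℝ (vS α) Z = inner ℝ Y Z := by
  simp only [inner_wS, inner_vS]
  rw [sum_idx_eq_half (fun i j => (toMat Y i i + toMat Y j j - 2 * toMat Y i j) * -toMat Z i j)
    (fun i j => by rw [toMat_symm Y i j, toMat_symm Z i j]; ring) (fun i => by ring),
    inner_eq_sum]
  have h : ∀ i j, (toMat Y i i + toMat Y j j - 2 * toMat Y i j) * -toMat Z i j =
      2 * (toMat Y i j * toMat Z i j) - toMat Y i i * toMat Z i j - toMat Y j j * toMat Z j i :=
    fun i j => by rw [toMat_symm Z j i]; ring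
  simp only [h, Finset.sum_sub_distrib, ← Finset.mul_sum, sum_row]
  rw [Finset.sum_comm (f := fun i j => toMat Y j j * toMat Z j i)]
  simp only [← Finset.mul_sum, sum_row]
  simp

theorem sum_inner_vS_sq_le (Y : SMat n) : ∑ α : Idx n, inner ℝ (vS α) Y ^ 2 ≤ ‖Y‖ ^ 2 := by
  have h := sum_idx_eq_half (fun i j => if i = j then 0 else toMat Y i j ^ 2)
    (fun i j => by rw [toMat_symm Y i j]; simp [eq_comm]) (fun i => by simp)
  have h1 : ∑ α : Idx n, inner ℝ (vS α) Y ^ 2 =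
      ∑ α : Idx n, if α.1.1 = α.1.2 then 0 else toMat Y α.1.1 α.1.2 ^ 2 :=
    Finset.sum_congr rfl fun α _ => by rw [inner_vS, if_neg α.2.ne, neg_sq]
  have h2 : ∑ i, ∑ j, (if i = j then 0 else toMat Y i j ^ 2) ≤ ‖Y‖ ^ 2 := by
    rw [norm_sq_eq_sum]
    refine Finset.sum_le_sum fun i _ => Finset.sum_le_sum fun j _ => ?_
    split_ifs
    · positivity
    · exact le_rfl
  rw [h1, h]
  nlinarith [sq_nonneg ‖Y‖]

/-- The diagonal is kept apart because it alone carries the factor `n`. -/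
theorem sum_inner_wS_sq_le (Y : SMat n) :
    ∑ α : Idx n, inner ℝ (wS α) Y ^ 2 ≤ 4 * n * ∑ i, toMat Y i i ^ 2 + 4 * ‖Y‖ ^ 2 := by
  simp only [inner_wS]
  rw [sum_idx_eq_half (fun i j => (toMat Y i i + toMat Y j j - 2 * toMat Y i j) ^ 2)
    (fun i j => by rw [toMat_symm Y i j]; ring) (fun i => by ring), norm_sq_eq_sum]
  have h : ∑ i, ∑ j, (toMat Y i i + toMat Y j j - 2 * toMat Y i j) ^ 2 ≤
      ∑ i, ∑ j, (4 * toMat Y i i ^ 2 + 4 * toMat Y j j ^ 2 + 8 * toMat Y i j ^ 2) :=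
    Finset.sum_le_sum fun i _ => Finset.sum_le_sum fun j _ => by
      nlinarith [sq_nonneg (toMat Y i i - toMat Y j j),
        sq_nonneg (toMat Y i i + toMat Y j j + 2 * toMat Y i j)]
  have h2 : ∑ i, ∑ j, (4 * toMat Y i i ^ 2 + 4 * toMat Y j j ^ 2 + 8 * toMat Y i j ^ 2) =
      8 * n * ∑ i, toMat Y i i ^ 2 + 8 * ∑ i, ∑ j, toMat Y i j ^ 2 := by
    simp only [Finset.sum_add_distrib, Finset.sum_const, ← Finset.mul_sum, Finset.card_univ,
      Fintype.card_fin, nsmul_eq_mul]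
    ring
  rw [h2] at h
  linarith

end SMat

/-! ### The projection `P_𝕋` and consequences of incoherence. -/

namespace GroundTruth

variable {n r : ℕ} (G : GroundTruth n r)

theorem PU_transpose : G.PUᵀ = G.PU := by simp [PU]

theorem PU_mul_PU : G.PU * G.PU = G.PU := by
  rw [PU, show G.U * G.Uᵀ * (G.U * G.Uᵀ) = G.U * (G.Uᵀ * G.U) * G.Uᵀ by
    simp only [Matrix.mul_assoc], G.orth, Matrix.mul_one]

theorem trace_PU : trace G.PU = r := by
  rw [PU, trace_mul_comm, G.orth]
  simp

theorem PT_apply (Y : Matrix (Fin n) (Fin n) ℝ) :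
    G.PT Y = G.PU * Y + Y * G.PU - G.PU * Y * G.PU := rfl

theorem toMat_PTS (Y : SMat n) : SMat.toMat (G.PTS Y) = G.PT (SMat.toMat Y) := rfl

theorem trace_PU_mul_add (M : Matrix (Fin n) (Fin n) ℝ) :
    trace ((G.PU * M)ᵀ * (G.PU * M)) + trace ((M - G.PU * M)ᵀ * (M - G.PU * M)) =
      trace (Mᵀ * M) := by
  have h : Mᵀ * G.PU * (G.PU * M) = Mᵀ * G.PU * M := by
    rw [Matrix.mul_assoc, ← Matrix.mul_assoc G.PU, G.PU_mul_PU, Matrix.mul_assoc]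
  rw [transpose_sub, transpose_mul, G.PU_transpose, Matrix.sub_mul, Matrix.mul_sub, Matrix.mul_sub,
    h, ← Matrix.mul_assoc, sub_self, sub_zero, ← trace_add]
  congr 1
  abel

theorem trace_mul_PU_le (M : Matrix (Fin n) (Fin n) ℝ) :
    trace ((M * G.PU)ᵀ * (M * G.PU)) ≤ trace (Mᵀ * M) := by
  have h := G.trace_PU_mul_add Mᵀ
  have h1 : G.PU * Mᵀ = (M * G.PU)ᵀ := by rw [transpose_mul, G.PU_transpose]
  rw [h1, transpose_transpose, transpose_transpose, trace_mul_comm (M * G.PU),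
    trace_mul_comm M] at h
  linarith [trace_transpose_mul_self_nonneg (Mᵀ - (M * G.PU)ᵀ)]

theorem sum_PU_sq (i : Fin n) : ∑ k, G.PU i k ^ 2 = G.PU i i := by
  conv_rhs => rw [← G.PU_mul_PU, mul_apply]
  refine Finset.sum_congr rfl fun k _ => ?_
  rw [sq]
  congr 1
  exact congrFun (congrFun G.PU_transpose k) i

theorem PT_idem (Y : Matrix (Fin n) (Fin n) ℝ) : G.PT (G.PT Y) = G.PT Y := by
  have h : ∀ M, G.PU * (G.PU * M) = G.PU * M := fun M => by rw [← Matrix.mul_assoc, G.PU_mul_PU]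
  simp only [PT_apply, Matrix.mul_add, Matrix.mul_sub, Matrix.add_mul, Matrix.sub_mul,
    Matrix.mul_assoc, h, G.PU_mul_PU]
  abel

theorem PTS_idem (Y : SMat n) : G.PTS (G.PTS Y) = G.PTS Y :=
  SMat.toMat_injective (by rw [toMat_PTS, toMat_PTS, PT_idem])

theorem inner_PTS_left (Y Z : SMat n) : inner ℝ (G.PTS Y) Z = inner ℝ Y (G.PTS Z) := by
  rw [SMat.inner_eq, SMat.inner_eq, toMat_PTS, toMat_PTS, PT_apply, PT_apply]
  simp only [transpose_add, transpose_sub, transpose_mul, G.PU_transpose, Matrix.add_mul,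
    Matrix.sub_mul, Matrix.mul_add, Matrix.mul_sub, trace_add, trace_sub]
  rw [Matrix.mul_assoc _ G.PU, Matrix.mul_assoc G.PU _ (SMat.toMat Z), trace_mul_comm G.PU,
    Matrix.mul_assoc G.PU, trace_mul_comm G.PU]
  simp only [Matrix.mul_assoc]

theorem adjoint_PTS : ContinuousLinearMap.adjoint G.PTS = G.PTS :=
  (ContinuousLinearMap.eq_adjoint_iff _ _).mpr G.inner_PTS_left |>.symm

theorem norm_PTS_apply_le (Y : SMat n) : ‖G.PTS Y‖ ≤ ‖Y‖ := by
  have h : ‖G.PTS Y‖ ^ 2 ≤ ‖G.PTS Y‖ * ‖Y‖ := by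
    rw [← real_inner_self_eq_norm_sq, G.inner_PTS_left, G.PTS_idem, real_inner_comm]
    exact real_inner_le_norm _ _
  rcases (norm_nonneg (G.PTS Y)).eq_or_lt with h0 | h0
  · rw [← h0]; exact norm_nonneg _
  · exact le_of_mul_le_mul_left (by rwa [sq] at h) h0

/-- Taking adjoints preserves the operator norm and fixes `P_𝕋`. -/
theorem ripDev_adjoint (m : ℕ) (A : SMat n →L[ℝ] SMat n) :
    G.ripDev m (ContinuousLinearMap.adjoint A) = G.ripDev m A := by
  rw [ripDev, ripDev, ← LinearIsometryEquiv.norm_map ContinuousLinearMap.adjoint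
    (G.PTS ∘L A ∘L G.PTS - ((m : ℝ) / numIdx n) • G.PTS), map_sub, map_smulₛₗ,
    ContinuousLinearMap.adjoint_comp, ContinuousLinearMap.adjoint_comp, G.adjoint_PTS]
  rfl

/-- Diagonal entries of `P_𝕋 Y` are small when the column space is incoherent. -/
theorem sum_diag_PTS_sq_le {c : ℝ} (hc : ∀ i, G.PU i i ≤ c) (Y : SMat n) :
    ∑ i, SMat.toMat (G.PTS Y) i i ^ 2 ≤ 4 * c * ‖Y‖ ^ 2 := by
  -- `P_𝕋 Y = P_U Y + M P_U`, and `P_U Y` has the same diagonal as `Y P_U` by symmetry. So a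
  -- diagonal entry pairs rows of `Y` and `M` with a column of `P_U`, of squared length `P_U i i`;
  -- Cauchy–Schwarz finishes.
  set M := SMat.toMat Y - G.PU * SMat.toMat Y with hM
  have hMY : ∑ i, ∑ j, M i j ^ 2 ≤ ‖Y‖ ^ 2 := by
    have h := G.trace_PU_mul_add (SMat.toMat Y)
    have h0 := trace_transpose_mul_self_nonneg (G.PU * SMat.toMat Y)
    rw [← SMat.inner_eq, real_inner_self_eq_norm_sq, ← hM, trace_transpose_mul M M] at h
    simp only [← sq] at h
    linarith
  have hrow : ∀ A : Matrix (Fin n) (Fin n) ℝ, (∑ i, (A * G.PU) i i ^ 2) ≤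
      c * ∑ i, ∑ j, A i j ^ 2 := fun A => by
    rw [Finset.mul_sum]
    refine Finset.sum_le_sum fun i _ => ?_
    rw [mul_apply]
    refine (Finset.sum_mul_sq_le_sq_mul_sq _ _ _).trans ?_
    have : ∑ k, G.PU k i ^ 2 = G.PU i i := by
      rw [← G.sum_PU_sq i]
      exact Finset.sum_congr rfl fun k _ => by rw [← congrFun (congrFun G.PU_transpose k) i]; rfl
    rw [this, mul_comm]
    exact mul_le_mul_of_nonneg_right (hc i) (Finset.sum_nonneg fun _ _ => sq_nonneg _)
  have hdec : ∀ i, SMat.toMat (G.PTS Y) i i = (SMat.toMat Y * G.PU) i i + (M * G.PU) i i :=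
    fun i => by
      have ht : (SMat.toMat Y * G.PU) i i = (G.PU * SMat.toMat Y) i i := by
        rw [← transpose_apply (SMat.toMat Y * G.PU), transpose_mul, G.PU_transpose,
          (SMat.toMat_mem Y).1]
      rw [toMat_PTS, PT_apply, ht, hM, Matrix.sub_mul]
      rw [Matrix.sub_apply, Matrix.add_apply, Matrix.sub_apply]
      ring
  have hY := hrow (SMat.toMat Y)
  rw [← SMat.norm_sq_eq_sum] at hY
  have hM' := hrow M
  calc ∑ i, SMat.toMat (G.PTS Y) i i ^ 2
      ≤ ∑ i, (2 * (SMat.toMat Y * G.PU) i i ^ 2 + 2 * (M * G.PU) i i ^ 2) :=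
        Finset.sum_le_sum fun i _ => by
          rw [hdec]
          nlinarith [sq_nonneg ((SMat.toMat Y * G.PU) i i - (M * G.PU) i i)]
    _ = 2 * ∑ i, (SMat.toMat Y * G.PU) i i ^ 2 + 2 * ∑ i, (M * G.PU) i i ^ 2 := by
        rw [Finset.sum_add_distrib, Finset.mul_sum, Finset.mul_sum]
    _ ≤ 4 * c * ‖Y‖ ^ 2 := by
        rcases isEmpty_or_nonempty (Fin n) with hn | ⟨⟨i⟩⟩
        · have : ‖Y‖ ^ 2 = 0 := by rw [SMat.norm_sq_eq_sum]; simp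
          rw [this]
          simp
        · have hc0 : 0 ≤ c := (by
            rw [← G.sum_PU_sq i]; exact Finset.sum_nonneg fun _ _ => sq_nonneg _ :
              0 ≤ G.PU i i).trans (hc i)
          have := mul_le_mul_of_nonneg_left hMY hc0
          linarith

variable {G} {ν : ℝ}

theorem Incoherent.PU_diag_le (hν : G.Incoherent ν) (hn : 2 ≤ n) (i : Fin n) :
    G.PU i i ≤ ν * r / (128 * n) := by
  have hc : 0 ≤ ν * r / (128 * n) := by
    have := hν.one_le
    positivity
  by_cases hi : (i : ℕ) + 1 < n
  · have h := trace_transpose_mul_self_le_of_frobNorm_le hc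
      (hν.PU_e ⟨(i, ⟨i + 1, hi⟩), Fin.lt_def.mpr (Nat.lt_succ_self _)⟩)
    rw [transpose_mul, G.PU_transpose, Matrix.mul_assoc, ← Matrix.mul_assoc G.PU, G.PU_mul_PU] at h
    simpa [e, Matrix.trace_single_mul] using h
  -- The last index is never the smaller of a pair, so `P_U e_{ij}` cannot reach it. Instead `(P_𝕋
  -- e_{0i}) P_U = e_{0i} P_U`, with squared norm `P_U i i`.
  · have hi0 : (⟨0, by omega⟩ : Fin n) < i := Fin.lt_def.mpr (by simp; omega)
    have h := trace_transpose_mul_self_le_of_frobNorm_le hc (hν.PT_e ⟨(⟨0, by omega⟩, i), hi0⟩)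
    have h1 := (G.trace_mul_PU_le _).trans h
    have h2 : ∀ M, G.PT M * G.PU = M * G.PU := fun M => by
      rw [PT_apply]
      simp only [Matrix.add_mul, Matrix.sub_mul, Matrix.mul_assoc, G.PU_mul_PU]
      abel
    rw [h2, trace_mul_comm, transpose_mul, G.PU_transpose, Matrix.mul_assoc,
      ← Matrix.mul_assoc G.PU, G.PU_mul_PU] at h1
    simpa [e, Matrix.trace_single_mul] using h1

/-- Sum the diagonal bounds against `trace P_U = r`. This slack absorbs lower-order terms later. -/
theorem Incoherent.le_param (hν : G.Incoherent ν) (hn : 2 ≤ n) (hr : 1 ≤ r) : 128 ≤ ν := by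
  have h := Finset.sum_le_sum fun i (_ : i ∈ Finset.univ) => hν.PU_diag_le hn i
  have ht : ∑ i, G.PU i i = r := G.trace_PU
  have hn0 : (0 : ℝ) < n := by positivity
  have hr0 : (0 : ℝ) < r := by positivity
  rw [ht, Finset.sum_const, Finset.card_univ, Fintype.card_fin, nsmul_eq_mul] at h
  have h' : (n : ℝ) * (ν * r / (128 * n)) = ν / 128 * r := by field_simp
  rw [h'] at h
  have := le_of_mul_le_mul_right (by linarith : 1 * (r : ℝ) ≤ ν / 128 * r) hr0
  linarith

/-- The diagonal incoherence cancels the factor `n`, leaving `νr/8`; the remaining `4 ‖Y‖²` is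
absorbed by `νr ≥ 128`. -/
theorem Incoherent.sum_inner_wS_PTS_sq_le (hν : G.Incoherent ν) (hn : 2 ≤ n) (hr : 1 ≤ r)
    (Y : SMat n) : ∑ α : Idx n, inner ℝ (wS α) (G.PTS Y) ^ 2 ≤ ν * r * ‖Y‖ ^ 2 := by
  have h1 := SMat.sum_inner_wS_sq_le (G.PTS Y)
  have h2 := G.sum_diag_PTS_sq_le (hν.PU_diag_le hn) Y
  have h3 : ‖G.PTS Y‖ ^ 2 ≤ ‖Y‖ ^ 2 := pow_le_pow_left₀ (norm_nonneg _) (G.norm_PTS_apply_le Y) 2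
  have hn0 : (0 : ℝ) < n := by positivity
  have hr1 : (1 : ℝ) ≤ r := by exact_mod_cast hr
  have h4 := mul_le_mul_of_nonneg_left h2 (by positivity : (0 : ℝ) ≤ 4 * n)
  have h5 : 4 * n * (4 * (ν * r / (128 * n)) * ‖Y‖ ^ 2) = ν * r / 8 * ‖Y‖ ^ 2 := by
    field_simp
    ring
  have h6 : 128 ≤ ν * r := by nlinarith [hν.le_param hn hr]
  nlinarith [sq_nonneg ‖Y‖]

end GroundTruth

end EDG

/-! ### Centred samples, their Bernstein parameters, and the tail bound. -/

namespace EDG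

namespace GroundTruth

variable {n r : ℕ} (G : GroundTruth n r)

/-- The centred contribution `P_𝕋 (⟨·, w_α⟩ v_α) P_𝕋 - L⁻¹ P_𝕋` of one sample. -/
noncomputable def centeredSample (α : Idx n) : SMat n →L[ℝ] SMat n :=
  (innerSL ℝ (G.PTS (wS α))).smulRight (G.PTS (vS α)) - (numIdx n)⁻¹ • G.PTS

theorem centeredSample_apply (α : Idx n) (Y : SMat n) : G.centeredSample α Y =
    inner ℝ (wS α) (G.PTS Y) • G.PTS (vS α) - (numIdx n)⁻¹ • G.PTS Y := by
  rw [← G.inner_PTS_left]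
  rfl

theorem adjoint_centeredSample_apply (α : Idx n) (Y : SMat n) :
    ContinuousLinearMap.adjoint (G.centeredSample α) Y =
      inner ℝ (vS α) (G.PTS Y) • G.PTS (wS α) - (numIdx n)⁻¹ • G.PTS Y := by
  refine ext_inner_right ℝ fun Z => ?_
  rw [ContinuousLinearMap.adjoint_inner_left, centeredSample_apply, inner_sub_right,
    inner_sub_left, inner_smul_left, inner_smul_left, inner_smul_right, inner_smul_right,
    G.inner_PTS_left Y Z, G.inner_PTS_left (wS α) Z, ← G.inner_PTS_left Y (vS α),
    real_inner_comm (vS α) (G.PTS Y), RCLike.conj_to_real, RCLike.conj_to_real]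
  ring

theorem sum_inner_wS_smul_PTS_vS (Y : SMat n) :
    ∑ α : Idx n, inner ℝ (wS α) (G.PTS Y) • G.PTS (vS α) = G.PTS Y := by
  refine ext_inner_right ℝ fun Z => ?_
  rw [sum_inner]
  simp only [inner_smul_left, RCLike.conj_to_real, G.inner_PTS_left (vS _)]
  rw [SMat.sum_inner_wS_mul_inner_vS, ← G.inner_PTS_left, G.PTS_idem]

theorem sum_inner_vS_smul_PTS_wS (Y : SMat n) :
    ∑ α : Idx n, inner ℝ (vS α) (G.PTS Y) • G.PTS (wS α) = G.PTS Y := by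
  refine ext_inner_right ℝ fun Z => ?_
  rw [sum_inner]
  simp only [inner_smul_left, RCLike.conj_to_real, G.inner_PTS_left (wS _),
    mul_comm (inner ℝ (vS _) _)]
  rw [SMat.sum_inner_wS_mul_inner_vS, G.inner_PTS_left, real_inner_comm, G.inner_PTS_left,
    real_inner_comm, G.inner_PTS_left, G.PTS_idem, real_inner_comm]

theorem sum_centeredSample (hn : numIdx n ≠ 0) : ∑ α, G.centeredSample α = 0 := by
  ext1 Y
  rw [_root_.sum_apply]
  simp only [centeredSample_apply]
  rw [Finset.sum_sub_distrib, sum_inner_wS_smul_PTS_vS, Finset.sum_const, Finset.card_univ,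
    ← Nat.cast_smul_eq_nsmul ℝ, card_idx, smul_smul, mul_inv_cancel₀ hn, one_smul, sub_self]
  rfl

theorem sum_centeredSample_comp {m : ℕ} (ω : Fin m → Idx n) : ∑ k, G.centeredSample (ω k) =
    G.PTS ∘L sampling ω ∘L G.PTS - ((m : ℝ) / numIdx n) • G.PTS := by
  ext1 Y
  rw [_root_.sum_apply]
  simp only [centeredSample_apply]
  rw [Finset.sum_sub_distrib, Finset.sum_const, Finset.card_univ, Fintype.card_fin,
    ← Nat.cast_smul_eq_nsmul ℝ, smul_smul, ← div_eq_mul_inv]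
  simp [sampling, map_sum]

variable {G} {ν : ℝ}

theorem Incoherent.norm_sq_PTS_wS_le (hν : G.Incoherent ν) (α : Idx n) :
    ‖G.PTS (wS α)‖ ^ 2 ≤ ν * r / (8 * n) := by
  have := hν.one_le
  rw [SMat.norm_eq_frobNorm]
  exact (Real.le_sqrt (Real.sqrt_nonneg _) (by positivity)).mp (hν.PT_w α)

theorem Incoherent.norm_sq_PTS_vS_le (hν : G.Incoherent ν) (α : Idx n) :
    ‖G.PTS (vS α)‖ ^ 2 ≤ ν * r / (2 * n) := by
  have := hν.one_le
  rw [SMat.norm_eq_frobNorm]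
  exact (Real.le_sqrt (Real.sqrt_nonneg _) (by positivity)).mp (hν.PT_v α)

theorem numIdx_pos (hn : 2 ≤ n) : 0 < numIdx n := by
  have : (2 : ℝ) ≤ n := by exact_mod_cast hn
  have : (0 : ℝ) < n - 1 := by linarith
  rw [numIdx]
  positivity

theorem Incoherent.norm_centeredSample_le (hν : G.Incoherent ν) (hn : 3 ≤ n) (hr : 1 ≤ r)
    (α : Idx n) : ‖G.centeredSample α‖ ≤ ν * r / (2 * n) := by
  have hn3 : (3 : ℝ) ≤ n := by exact_mod_cast hn
  have hr1 : (1 : ℝ) ≤ r := by exact_mod_cast hr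
  have hνr : 128 ≤ ν * r := by nlinarith [hν.le_param (by omega) hr]
  have hL := numIdx_pos (n := n) (by omega)
  have h1 : ‖(innerSL ℝ (G.PTS (wS α))).smulRight (G.PTS (vS α))‖ ≤ ν * r / (4 * n) := by
    rw [ContinuousLinearMap.norm_smulRight_apply, innerSL_apply_norm]
    refine abs_le_of_sq_le_sq' ?_ (by positivity) |>.2
    rw [mul_pow]
    refine (mul_le_mul (hν.norm_sq_PTS_wS_le α) (hν.norm_sq_PTS_vS_le α) (by positivity)
      (by positivity)).trans (le_of_eq ?_)
    field_simp
    ring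
  -- Here `1/L = 2/(n(n-1))` is negligible because `νr ≥ 128`.
  have h2 : ‖(numIdx n)⁻¹ • G.PTS‖ ≤ ν * r / (4 * n) := by
    refine (ContinuousLinearMap.opNorm_le_bound _ (inv_nonneg.mpr hL.le) fun Y => ?_).trans
      (?_ : (numIdx n)⁻¹ ≤ _)
    · rw [_root_.smul_apply, norm_smul, norm_inv, Real.norm_of_nonneg hL.le]
      exact mul_le_mul_of_nonneg_left (G.norm_PTS_apply_le Y) (inv_nonneg.mpr hL.le)
    rw [inv_le_comm₀ hL (by positivity), inv_div, numIdx, div_le_div_iff₀ (by positivity) two_pos]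
    nlinarith [mul_pos (by linarith : (0 : ℝ) < n) (by linarith : (0 : ℝ) < n - 1)]
  refine (norm_sub_le _ _).trans ((add_le_add h1 h2).trans (le_of_eq ?_))
  field_simp
  ring

/-- After dropping the centring, bound `‖P_𝕋 v_α‖` uniformly and sum the `w`-coefficients. -/
theorem Incoherent.sum_norm_centeredSample_sq_le (hν : G.Incoherent ν) (hn : 2 ≤ n) (hr : 1 ≤ r)
    (Y : SMat n) : ∑ α, ‖G.centeredSample α Y‖ ^ 2 ≤ (ν * r) ^ 2 / (2 * n) * ‖Y‖ ^ 2 := by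
  have hL := numIdx_pos hn
  have hν1 := hν.one_le
  simp only [centeredSample_apply]
  refine (sum_norm_sub_sq_le _ ?_).trans ?_
  · rw [sum_inner_wS_smul_PTS_vS, card_idx, smul_smul, mul_inv_cancel₀ hL.ne', one_smul]
  · calc ∑ α : Idx n, ‖inner ℝ (wS α) (G.PTS Y) • G.PTS (vS α)‖ ^ 2
        ≤ ∑ α : Idx n, inner ℝ (wS α) (G.PTS Y) ^ 2 * (ν * r / (2 * n)) :=
          Finset.sum_le_sum fun α _ => by
            rw [norm_smul, mul_pow, Real.norm_eq_abs, sq_abs]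
            exact mul_le_mul_of_nonneg_left (hν.norm_sq_PTS_vS_le α) (sq_nonneg _)
      _ = (∑ α : Idx n, inner ℝ (wS α) (G.PTS Y) ^ 2) * (ν * r / (2 * n)) := by
          rw [Finset.sum_mul]
      _ ≤ ν * r * ‖Y‖ ^ 2 * (ν * r / (2 * n)) :=
          mul_le_mul_of_nonneg_right (hν.sum_inner_wS_PTS_sq_le hn hr Y) (by positivity)
      _ = _ := by ring

/-- The roles of `w` and `v` are exchanged. The natural bound is only linear in `νr`; it is relaxed
to share one variance parameter. -/
theorem Incoherent.sum_norm_adjoint_centeredSample_sq_le (hν : G.Incoherent ν) (hn : 2 ≤ n)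
    (hr : 1 ≤ r) (Y : SMat n) :
    ∑ α, ‖ContinuousLinearMap.adjoint (G.centeredSample α) Y‖ ^ 2 ≤
      (ν * r) ^ 2 / (2 * n) * ‖Y‖ ^ 2 := by
  have hL := numIdx_pos hn
  have hν1 := hν.one_le
  have hr1 : (1 : ℝ) ≤ r := by exact_mod_cast hr
  have hn0 : (0 : ℝ) < n := by positivity
  simp only [adjoint_centeredSample_apply]
  refine (sum_norm_sub_sq_le _ ?_).trans ?_
  · rw [sum_inner_vS_smul_PTS_wS, card_idx, smul_smul, mul_inv_cancel₀ hL.ne', one_smul]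
  · calc ∑ α : Idx n, ‖inner ℝ (vS α) (G.PTS Y) • G.PTS (wS α)‖ ^ 2
        ≤ ∑ α : Idx n, inner ℝ (vS α) (G.PTS Y) ^ 2 * (ν * r / (8 * n)) :=
          Finset.sum_le_sum fun α _ => by
            rw [norm_smul, mul_pow, Real.norm_eq_abs, sq_abs]
            exact mul_le_mul_of_nonneg_left (hν.norm_sq_PTS_wS_le α) (sq_nonneg _)
      _ = (∑ α : Idx n, inner ℝ (vS α) (G.PTS Y) ^ 2) * (ν * r / (8 * n)) := by
          rw [Finset.sum_mul]
      _ ≤ ‖Y‖ ^ 2 * (ν * r / (8 * n)) :=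
          mul_le_mul_of_nonneg_right ((SMat.sum_inner_vS_sq_le _).trans
            (pow_le_pow_left₀ (norm_nonneg _) (G.norm_PTS_apply_le Y) 2)) (by positivity)
      _ ≤ ‖Y‖ ^ 2 * ((ν * r) ^ 2 / (2 * n)) := by
          refine mul_le_mul_of_nonneg_left ?_ (sq_nonneg _)
          have hνr : 1 ≤ ν * r := by nlinarith
          rw [div_le_div_iff₀ (by positivity) (by positivity)]
          nlinarith [mul_le_mul_of_nonneg_right hνr (by positivity : (0 : ℝ) ≤ ν * r * n)]
      _ = _ := by ring

theorem ripDev_of_rank_zero (G : GroundTruth n 0) (m : ℕ) (A : SMat n →L[ℝ] SMat n) :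
    G.ripDev m A = 0 := by
  have hU : G.PU = 0 := by
    ext i j
    simp [PU, mul_apply]
  have hP : G.PTS = 0 := by
    ext1 Y
    apply SMat.toMat_injective
    rw [toMat_PTS, PT_apply, hU]
    simp
  have h0 : ((m : ℝ) / numIdx n) • (0 : SMat n →L[ℝ] SMat n) = 0 := by
    ext1 Y
    exact smul_zero ((m : ℝ) / numIdx n)
  rw [ripDev, hP, h0, ContinuousLinearMap.zero_comp, sub_zero]
  exact mul_eq_zero_of_right _ ContinuousLinearMap.opNorm_zero

/-- The tail bound for the restricted isometry deviation of the sampling operator. -/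
theorem Incoherent.measureReal_lt_ripDev_le (hν : G.Incoherent ν) (hn : 3 ≤ n) (hr : 1 ≤ r)
    {m : ℕ} {β : ℝ} (hβ : 1 < β) {S : Type*} [MeasurableSpace S] {μ : Measure S}
    [IsProbabilityMeasure μ] {Ω : Fin m → S → Idx n} (hindep : iIndepFun Ω μ)
    (hunif : ∀ k, ∀ α : Idx n, μ.real {s | Ω k s = α} = 1 / numIdx n)
    (hm : 8 / 3 * β * ν ^ 2 * (r : ℝ) ^ 2 * n * Real.log n ≤ m) :
    μ.real {s | √(8 * β * ν ^ 2 * (r : ℝ) ^ 2 * n * Real.log n / (3 * m)) <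
      G.ripDev m (sampling fun k => Ω k s)} ≤ 2 * (n : ℝ) ^ (1 - β) := by
  classical
  have hn3 : (3 : ℝ) ≤ n := by exact_mod_cast hn
  have hr1 : (1 : ℝ) ≤ r := by exact_mod_cast hr
  have hL := numIdx_pos (n := n) (by omega)
  have hlog : 0 < Real.log n := Real.log_pos (by linarith)
  have hνr : 128 ≤ ν * r := by nlinarith [hν.le_param (by omega) hr]
  set a := ν * r with ha
  set L := numIdx n with hLdef
  have hX : 8 * β * ν ^ 2 * (r : ℝ) ^ 2 * n * Real.log n = 8 * β * a ^ 2 * n * Real.log n := by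
    rw [ha]; ring
  have hm' : 8 / 3 * β * a ^ 2 * n * Real.log n ≤ m := by
    refine le_trans (le_of_eq ?_) hm
    rw [ha]; ring
  have hm0 : (0 : ℝ) < m := lt_of_lt_of_le (by positivity) hm'
  rw [hX]
  set τ := √(8 * β * a ^ 2 * n * Real.log n / (3 * m)) with hτ
  have hτ0 : 0 ≤ τ := Real.sqrt_nonneg _
  have hτsq : τ ^ 2 = 8 * β * a ^ 2 * n * Real.log n / (3 * m) := Real.sq_sqrt (by positivity)
  -- The sample-size condition enters here, to keep `θ` in the range `θR ≤ 1`.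
  have hτ1 : τ ≤ 1 := by
    rw [hτ, Real.sqrt_le_one, div_le_one (by positivity)]
    linarith
  have hcard : (Fintype.card (Idx n) : ℝ) = L := card_idx n
  have hV : (Fintype.card (Idx n) : ℝ) * (a ^ 2 / (2 * n * L)) = a ^ 2 / (2 * n) := by
    rw [hcard]
    field_simp
  have hset : {s | τ < G.ripDev m (sampling fun k => Ω k s)} =
      {s | τ * m / L < ‖∑ k, G.centeredSample (Ω k s)‖} := by
    ext s
    rw [Set.mem_ofPred_eq, Set.mem_ofPred_eq, sum_centeredSample_comp, ripDev, div_lt_iff₀ hL,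
      div_mul_eq_mul_div, lt_div_iff₀ hm0, mul_comm L]
  rw [hset]
  refine (measureReal_setOf_comp_le_card hindep hunif
    fun ω => τ * m / L < ‖∑ k, G.centeredSample (ω k)‖).trans ?_
  have hθR : τ * n / a ^ 2 * (a / (2 * n)) ≤ 1 := by
    have : τ * n / a ^ 2 * (a / (2 * n)) = τ / (2 * a) := by field_simp
    rw [this, div_le_one (by positivity)]
    linarith
  -- `θ = t / (2mV)` minimises the exponent `mθ²V - θt`.
  have hB := card_lt_norm_sum_le (A := G.centeredSample) (G.sum_centeredSample hL.ne')
    (R := a / (2 * n)) (V := a ^ 2 / (2 * n * L)) (θ := τ * n / a ^ 2) (t := τ * m / L)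
    (by positivity) (by positivity) (by positivity)
    (hν.norm_centeredSample_le hn hr) hθR
    (fun x => by rw [hV]; exact hν.sum_norm_centeredSample_sq_le (by omega) hr x)
    (fun x => by rw [hV]; exact hν.sum_norm_adjoint_centeredSample_sq_le (by omega) hr x) m
  refine (mul_le_mul_of_nonneg_right hB (by positivity)).trans ?_
  rw [hcard, one_div, inv_pow, mul_right_comm, mul_inv_cancel₀ (by positivity), one_mul]
  have hexp : m * ((τ * n / a ^ 2) ^ 2 * (a ^ 2 / (2 * n * L))) - τ * n / a ^ 2 * (τ * m / L) ≤
      Real.log n * (-(2 * β)) := by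
    have h1 : m * ((τ * n / a ^ 2) ^ 2 * (a ^ 2 / (2 * n * L))) - τ * n / a ^ 2 * (τ * m / L) =
        -(τ ^ 2 * (n * m / (2 * L * a ^ 2))) := by
      field_simp
      ring
    have h2 : τ ^ 2 * (n * m / (2 * L * a ^ 2)) = 4 / 3 * (n ^ 2 / L) * (β * Real.log n) := by
      rw [hτsq]
      field_simp
      norm_num
    have h3 : 2 ≤ (n : ℝ) ^ 2 / L := by
      rw [le_div_iff₀ hL, hLdef, numIdx]
      nlinarith
    rw [h1, h2]
    have h4 : 0 < β * Real.log n := by positivity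
    nlinarith
  -- This crude dimension bound suffices: the exponential gives `n ^ (-2β)`, and `2 - 2β ≤ 1 - β`
  -- for `β > 1`.
  have hd : (Module.finrank ℝ (SMat n) : ℝ) ≤ (n : ℝ) ^ (2 : ℝ) := by
    rw [Real.rpow_two]
    exact_mod_cast SMat.finrank_le n
  have hn0 : (0 : ℝ) < n := by positivity
  calc 2 * (Module.finrank ℝ (SMat n) : ℝ) * Real.exp _
      ≤ 2 * (n : ℝ) ^ (2 : ℝ) * (n : ℝ) ^ (-(2 * β)) := by
        rw [Real.rpow_def_of_pos hn0 (-(2 * β))]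
        gcongr
    _ = 2 * (n : ℝ) ^ (2 + -(2 * β)) := by rw [Real.rpow_add hn0]; ring
    _ ≤ 2 * (n : ℝ) ^ (1 - β) := by
        gcongr
        · linarith
        · linarith

end GroundTruth

end EDG

/-! ### The main theorem. -/

theorem theorem1 {n r m : ℕ} (hn : 3 ≤ n) (G : EDG.GroundTruth n r) (ν β : ℝ)
    (hν : G.Incoherent ν)
    {S : Type*} [MeasurableSpace S] (μ : Measure S) [IsProbabilityMeasure μ]
    (Ω : Fin m → S → EDG.Idx n)
    (hmeas : ∀ k, Measurable (Ω k))
    (hindep : iIndepFun Ω μ)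
    (hunif : ∀ k, ∀ α : EDG.Idx n, μ.real {s | Ω k s = α} = 1 / EDG.numIdx n)
    (hm : 8 / 3 * β * ν ^ 2 * (r : ℝ) ^ 2 * n * Real.log n ≤ m) :
    1 - 2 * (n : ℝ) ^ (1 - β) ≤ μ.real {s |
      -- the bound for `R_Ω` and for its adjoint
      (G.ripDev m (EDG.sampling fun k => Ω k s) ≤
          √(8 * β * ν ^ 2 * (r : ℝ) ^ 2 * n * Real.log n / (3 * m)) ∧
        G.ripDev m (ContinuousLinearMap.adjoint (EDG.sampling fun k => Ω k s)) ≤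
          √(8 * β * ν ^ 2 * (r : ℝ) ^ 2 * n * Real.log n / (3 * m))) ∧
      -- the consequence for a prescribed accuracy
      ∀ ε₀ : ℝ, 0 < ε₀ → 8 / 3 * β * (ν * r / ε₀) ^ 2 * n * Real.log n ≤ m →
        G.ripDev m (EDG.sampling fun k => Ω k s) ≤ ε₀ ∧
        G.ripDev m (ContinuousLinearMap.adjoint (EDG.sampling fun k => Ω k s)) ≤ ε₀} := by
  have hn3 : (3 : ℝ) ≤ n := by exact_mod_cast hn
  -- For `β ≤ 1` the claimed lower bound is negative.
  rcases le_or_gt β 1 with hβ | hβ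
  · have h1 : 1 ≤ (n : ℝ) ^ (1 - β) := Real.one_le_rpow (by linarith) (by linarith)
    exact le_trans (by linarith) measureReal_nonneg
  simp only [EDG.GroundTruth.ripDev_adjoint, and_self]
  set T := √(8 * β * ν ^ 2 * (r : ℝ) ^ 2 * n * Real.log n / (3 * m)) with hT
  set dev : S → ℝ := fun s => G.ripDev m (EDG.sampling fun k => Ω k s)
  have hTε : ∀ ε₀ : ℝ, 0 < ε₀ → 8 / 3 * β * (ν * r / ε₀) ^ 2 * n * Real.log n ≤ m → T ≤ ε₀ := by
    intro ε₀ hε h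
    refine Real.sqrt_le_iff.mpr ⟨hε.le, div_le_of_le_mul₀ (by positivity) (by positivity) ?_⟩
    have h' := mul_le_mul_of_nonneg_left h (by positivity : 0 ≤ 3 * ε₀ ^ 2)
    have h2 : 3 * ε₀ ^ 2 * (8 / 3 * β * (ν * r / ε₀) ^ 2 * n * Real.log n) =
        8 * β * ν ^ 2 * (r : ℝ) ^ 2 * n * Real.log n := by
      field_simp
    linarith
  have hgood : {s | dev s ≤ T} ⊆ {s | dev s ≤ T ∧ ∀ ε₀ : ℝ, 0 < ε₀ →
      8 / 3 * β * (ν * r / ε₀) ^ 2 * n * Real.log n ≤ m → dev s ≤ ε₀} :=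
    fun s hs => ⟨hs, fun ε₀ hε h => le_trans hs (hTε ε₀ hε h)⟩
  refine le_trans ?_ (measureReal_mono hgood)
  have hbad : μ.real {s | T < dev s} ≤ 2 * (n : ℝ) ^ (1 - β) := by
    -- Rank zero is separate: `P_𝕋` vanishes, and `ν ≥ 128` is no longer forced.
    rcases Nat.eq_zero_or_pos r with rfl | hr
    · have : {s | T < dev s} = ∅ := by
        ext s
        have : dev s = 0 := G.ripDev_of_rank_zero m _
        simp [this, T]
      rw [this, measureReal_empty]
      positivity
    · exact hν.measureReal_lt_ripDev_le hn hr hβ hindep hunif hm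
  have hunion : (Set.univ : Set S) = {s | dev s ≤ T} ∪ {s | T < dev s} := by
    ext s
    simpa using le_or_gt (dev s) T
  -- Subadditivity suffices to pass to the complement.
  have h1 : (1 : ℝ) ≤ μ.real {s | dev s ≤ T} + μ.real {s | T < dev s} := by
    rw [← probReal_univ (μ := μ), hunion]
    exact measureReal_union_le _ _
  linarith
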